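/- Theorem 1.1. Let $m\ge 1$. For a matrix function $a:\mathbb T\to\mathbb C^{m\times m}$ on the unit circle let $a_n$ ($n\in\mathbb Z$) be its Fourier coefficients, and let $W\cap K^{1/2,1/2}_{2,2}$ (Wiener algebra intersected with Krein algebra) be the set of all continuous $a$ with $\sum_{n\in\mathbb Z}\|a_n\|+\sum_{n\in\mathbb Z}|n|\,\|a_n\|^2<\infty$. Suppose that $a\in W\cap K^{1/2,1/2}_{2,2}$ has canonical right and left Wiener–Hopf factorizations $a=w_-w_+=v_+v_-$ in $W\cap K^{1/2,1/2}_{2,2}$, i.e. $w_+,v_+,\overline{w_-},\overline{v_-}$ are invertible on $\mathbb T$ and, together with their inverses, belong to $W\cap K^{1/2,1/2}_{2,2}\cap H^\infty$. Put $b=v_-w_+^{-1}$ and $c=w_-^{-1}v_+$. Let $P$ be the orthogonal projection of $L^2=L^2(\mathbb T;\mathbb C^m)$ onto the Hardy space $H^2$ of functions whose Fourier coefficients with negative index vanish. On $H^2$ let $T(\varphi)f=P(\varphi f)$ and $H(\varphi)f=P(\varphi\cdot(I-P)Jf)$, where $(Jf)(t)=t^{-1}f(t^{-1})$, be the Toeplitz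 and Hankel operators with symbol $\varphi$, and put $\tilde\varphi(t)=\varphi(1/t)$. For $\alpha\in\mathbb D$ let $$\mu_\alpha(z)=\frac{z-\alpha}{1-\overline\alpha z},\qquad B_\alpha(z)=\frac{-\overline\alpha}{|\alpha|}\,\mu_\alpha(z)\ (\alpha\neq 0),\qquad B_0(z)=z .$$ Let $u=B_{\alpha_1}\cdots B_{\alpha_N}$ with $\alpha_1,\dots,\alpha_N\in\mathbb D$ be a finite Blaschke product and let $\sigma(u)$ be the family $\alpha_1,\dots,\alpha_N$, with repetitions. Let $P_u$ be the orthogonal projection of $H^2$ onto the model space $K_u=H^2\ominus uH^2$, let $Q_u=I-P_u$, and let $T_u(a)=P_uT(a)|K_u$. Finally, for a matrix function $\varphi$ on $\mathbb T$ let $G(\varphi)=\exp\bigl(\frac1{2\pi}\int_0^{2\pi}\log\det\varphi(e^{i\theta})\,d\theta\bigr)$, where $\log\det\varphi$ is a continuous logarithm of $\det\varphi$ on $\mathbb T$. Then $K_u$ is finite-dimensional, $\det(a\circ\mu_{-\alpha})$ has a continuous logarithm on $\mathbb T$ for every $\alpha\in\sigma(u)$, the operators $H(b)H(\tilde c)$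 and $Q_uH(b)H(\tilde c)Q_u$ are of trace class, the Fredholm determinant $\det(I-H(b)H(\tilde c))$ is nonzero, and $$\det T_u(a)=\Bigl(\prod_{\alpha\in\sigma(u)}G(a\circ\mu_{-\alpha})\Bigr)\,\frac{\det\bigl(I-Q_uH(b)H(\tilde c)Q_u\bigr)}{\det\bigl(I-H(b)H(\tilde c)\bigr)} .$$ -/

import Mathlib

open MeasureTheory Filter Topology
open scoped ENNReal ComplexConjugate Complex.UnitDisc

noncomputable section

namespace ModelBO

/-! ### The space `L²(𝕋; ℂᵐ)` and the Hardy space `H²`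

The unit circle is parametrised by `x ↦ e^{2πix}`, `x ∈ ℝ/ℤ`, with normalised Haar measure.
Symbols are functions on `Circle`. -/

/-- The space `ℂᵐ` with its Hermitian inner product. -/
abbrev Vec (m : ℕ) : Type := EuclideanSpace ℂ (Fin m)

/-- Complex `m × m` matrices. -/
abbrev Mat (m : ℕ) : Type := Matrix (Fin m) (Fin m) ℂ

/-- The point `e^{2πix}` of the unit circle. -/
def pt (x : UnitAddCircle) : Circle := AddCircle.toCircle x

/-- `L²(𝕋; ℂᵐ)`. -/
abbrev L2 (m : ℕ) : Type := Lp (Vec m) 2 (AddCircle.haarAddCircle (T := (1 : ℝ)))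

/-- The `n`th Fourier coefficient as a bounded linear map on `L²(𝕋; ℂᵐ)`. -/
def coeffCLM (m : ℕ) (n : ℤ) : L2 m →L[ℂ] Vec m :=
  (ContinuousLinearMap.lsmul ℂ ℂ : ℂ →L[ℂ] Vec m →L[ℂ] Vec m).lpPairing
    (AddCircle.haarAddCircle (T := (1 : ℝ))) 2 2 (fourierLp 2 (-n))

lemma coeffCLM_apply (m : ℕ) (n : ℤ) (f : L2 m) : coeffCLM m n f = fourierCoeff f n := by
  rw [coeffCLM, ContinuousLinearMap.lpPairing_eq_integral, fourierCoeff]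
  refine integral_congr_ae ?_
  filter_upwards [coeFn_fourierLp (T := (1 : ℝ)) 2 (-n)] with x hx
  rw [hx]
  rfl

/-- The Hardy space `H²` of `ℂᵐ`-valued functions: all Fourier coefficients with negative index
vanish. -/
def H2 (m : ℕ) : Submodule ℂ (L2 m) where
  carrier := {f | ∀ n : ℤ, n < 0 → fourierCoeff f n = 0}
  add_mem' := by
    intro f g hf hg n hn
    have h1 := hf n hn
    have h2 := hg n hn
    rw [← coeffCLM_apply] at h1 h2 ⊢
    rw [map_add, h1, h2, add_zero]
  zero_mem' := by
    intro n _
    rw [← coeffCLM_apply, map_zero]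
  smul_mem' := by
    intro c f hf n hn
    have h1 := hf n hn
    rw [← coeffCLM_apply] at h1 ⊢
    rw [map_smul, h1, smul_zero]

lemma isClosed_H2 (m : ℕ) : IsClosed (H2 m : Set (L2 m)) := by
  have h : (H2 m : Set (L2 m)) = ⋂ n : ℤ, ⋂ _ : n < 0, {f | coeffCLM m n f = 0} := by
    ext f
    simp only [Set.mem_iInter, Set.mem_ofPred_eq, coeffCLM_apply]
    rfl
  rw [h]
  exact isClosed_iInter fun n => isClosed_iInter fun _ =>
    isClosed_eq (coeffCLM m n).continuous continuous_const

instance (m : ℕ) : CompleteSpace (H2 m) := (isClosed_H2 m).completeSpace_coe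

/-- The orthogonal projection `P` of `L²` onto `H²`. -/
def proj (m : ℕ) : L2 m →L[ℂ] H2 m := (H2 m).orthogonalProjectionOnto

/-! ### Multiplication, Toeplitz and Hankel operators -/

/-- The symbol as an operator-valued function on `ℝ/ℤ`. -/
def opSymbol {m : ℕ} (a : Circle → Mat m) (x : UnitAddCircle) : Vec m →L[ℂ] Vec m :=
  Matrix.toEuclideanCLM (𝕜 := ℂ) (a (pt x))

/-- The matrix function `a` belongs to `L^∞`. -/
def MemLInf {m : ℕ} (a : Circle → Mat m) : Prop :=
  MemLp (opSymbol a) ∞ (AddCircle.haarAddCircle (T := (1 : ℝ)))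

open Classical in
/-- Multiplication by the matrix function `a ∈ L^∞` on `L²` (set to `0` if `a ∉ L^∞`). -/
def mulOp {m : ℕ} (a : Circle → Mat m) : L2 m →L[ℂ] L2 m :=
  if h : MemLInf a then
    (ContinuousLinearMap.id ℂ (Vec m →L[ℂ] Vec m)).holderL
      (AddCircle.haarAddCircle (T := (1 : ℝ))) ∞ 2 2 (MemLp.toLp (opSymbol a) h)
  else 0

/-- A scalar function, regarded as the matrix function `u · I`. -/
def scalarSymbol (m : ℕ) (u : Circle → ℂ) : Circle → Mat m := fun t => u t • (1 : Mat m)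

/-- The Toeplitz operator `T(a) f = P (a f)` on `H²`. -/
def toeplitz {m : ℕ} (a : Circle → Mat m) : H2 m →L[ℂ] H2 m :=
  proj m ∘L mulOp a ∘L (H2 m).subtypeL

lemma measurePreserving_neg_circle :
    MeasurePreserving (fun x : UnitAddCircle => -x)
      (AddCircle.haarAddCircle (T := (1 : ℝ))) (AddCircle.haarAddCircle (T := (1 : ℝ))) :=
  Measure.measurePreserving_neg _

/-- The flip operator `(J f)(t) = t⁻¹ f(t⁻¹)` on `L²`. -/
def flip (m : ℕ) : L2 m →L[ℂ] L2 m :=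
  mulOp (scalarSymbol m fun t => ((t⁻¹ : Circle) : ℂ)) ∘L
    (Lp.compMeasurePreservingₗᵢ ℂ (fun x : UnitAddCircle => -x)
      measurePreserving_neg_circle).toContinuousLinearMap

/-- The Hankel operator `H(a) f = P (a · (I - P) J f)` on `H²`. -/
def hankel {m : ℕ} (a : Circle → Mat m) : H2 m →L[ℂ] H2 m :=
  proj m ∘L mulOp a ∘L (1 - (H2 m).starProjection) ∘L flip m ∘L (H2 m).subtypeL

/-- `ã(t) = a(1/t)`. -/
def tilde {m : ℕ} (a : Circle → Mat m) : Circle → Mat m := fun t => a t⁻¹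

/-! ### Model spaces -/

/-- The subspace `u H²` of `H²`. -/
def shiftedH2 (m : ℕ) (u : Circle → ℂ) : Submodule ℂ (H2 m) :=
  ((H2 m).map (mulOp (scalarSymbol m u)).toLinearMap).comap (H2 m).subtype

/-- The model space `K_u = H² ⊖ u H²`. -/
def modelSpace (m : ℕ) (u : Circle → ℂ) : Submodule ℂ (H2 m) := (shiftedH2 m u)ᗮ

instance (m : ℕ) (u : Circle → ℂ) : CompleteSpace (modelSpace m u) :=
  inferInstanceAs (CompleteSpace ((shiftedH2 m u)ᗮ : Submodule ℂ (H2 m)))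

/-- `Q_u = I - P_u`, where `P_u` is the orthogonal projection of `H²` onto `K_u`. -/
def Qu (m : ℕ) (u : Circle → ℂ) : H2 m →L[ℂ] H2 m := 1 - (modelSpace m u).starProjection

/-- The compression `T_u(a) = P_u T(a)|K_u`. -/
def modelToeplitz {m : ℕ} (u : Circle → ℂ) (a : Circle → Mat m) :
    modelSpace m u →L[ℂ] modelSpace m u :=
  (modelSpace m u).orthogonalProjectionOnto ∘L toeplitz a ∘L (modelSpace m u).subtypeL

/-! ### Blaschke products -/

/-- `μ_α(z) = (z - α) / (1 - ᾱ z)`. -/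
def moebius (α z : ℂ) : ℂ := (z - α) / (1 - conj α * z)

lemma norm_moebius (α : 𝔻) (t : Circle) : ‖moebius (α : ℂ) (t : ℂ)‖ = 1 := by
  have ht : (t : ℂ) * conj (t : ℂ) = 1 := by
    rw [Complex.mul_conj, Circle.normSq_coe, Complex.ofReal_one]
  have h1 : (1 - conj (α : ℂ) * t) = t * conj ((t : ℂ) - α) := by
    rw [map_sub, mul_sub, ht]; ring
  have h2 : (t : ℂ) - α ≠ 0 := by
    intro h
    have h3 := α.norm_ne_one
    rw [← sub_eq_zero.mp h] at h3
    exact h3 (Circle.norm_coe t)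
  rw [moebius, h1, norm_div, norm_mul, Circle.norm_coe, one_mul, RCLike.norm_conj]
  exact div_self (norm_ne_zero_iff.mpr h2)

/-- `μ_α` as a map of the unit circle to itself. -/
def moebiusCircle (α : 𝔻) (t : Circle) : Circle :=
  ⟨moebius (α : ℂ) (t : ℂ), mem_sphere_zero_iff_norm.mpr (norm_moebius α t)⟩

open Classical in
/-- The Blaschke factor `B_α`, with `B_0(z) = z`. -/
def blaschkeFactor (α z : ℂ) : ℂ :=
  if α = 0 then z else (-conj α / (‖α‖ : ℂ)) * moebius α z

/-- The boundary function of the finite Blaschke product `B_{α_1} ⋯ B_{α_N}`. -/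
def blaschke {N : ℕ} (α : Fin N → 𝔻) (t : Circle) : ℂ :=
  ∏ j, blaschkeFactor (α j : ℂ) (t : ℂ)

/-! ### The Wiener and Krein algebras and Wiener–Hopf factorizations -/

/-- The Fourier coefficient `a_n` of a matrix function. -/
def coeff {m : ℕ} (a : Circle → Mat m) (n : ℤ) : Mat m :=
  Matrix.of fun i j => fourierCoeff (fun x : UnitAddCircle => a (pt x) i j) n

open scoped Matrix.Norms.Elementwise in
/-- The intersection of the Wiener algebra and the Krein algebra `K^{1/2,1/2}_{2,2}`: continuous
matrix functions with `∑ ‖a_n‖ + ∑ |n| ‖a_n‖² < ∞`. -/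
def MemWK {m : ℕ} (a : Circle → Mat m) : Prop :=
  Continuous a ∧ Summable (fun n : ℤ => ‖coeff a n‖) ∧
    Summable (fun n : ℤ => |(n : ℝ)| * ‖coeff a n‖ ^ 2)

/-- The matrix function `a` belongs to `H^∞`. -/
def MemHInf {m : ℕ} (a : Circle → Mat m) : Prop :=
  MemLInf a ∧ ∀ n : ℤ, n < 0 → coeff a n = 0

/-- Pointwise inverse of a matrix function. -/
def invSymbol {m : ℕ} (a : Circle → Mat m) : Circle → Mat m := fun t => (a t)⁻¹

/-- Entrywise complex conjugate of a matrix function. -/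
def conjSymbol {m : ℕ} (a : Circle → Mat m) : Circle → Mat m := fun t => (a t).map conj

/-- `w` is invertible, and `w` and its inverse belong to `W ∩ K^{1/2,1/2}_{2,2} ∩ H^∞`. -/
structure IsPlusFactor {m : ℕ} (w : Circle → Mat m) : Prop where
  isUnit : ∀ t, IsUnit (w t)
  memWK : MemWK w
  memHInf : MemHInf w
  inv_memWK : MemWK (invSymbol w)
  inv_memHInf : MemHInf (invSymbol w)

/-- `w̄` and its inverse belong to `W ∩ K^{1/2,1/2}_{2,2} ∩ H^∞`. -/
def IsMinusFactor {m : ℕ} (w : Circle → Mat m) : Prop := IsPlusFactor (conjSymbol w)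

/-! ### Geometric mean -/

/-- `g` is the geometric mean `G(φ) = exp((1/2π) ∫₀^{2π} log det φ(e^{iθ}) dθ)`, where `log det φ`
is a continuous logarithm of `det φ` on the circle (it is unique up to an additive constant in
`2πiℤ`, so that `g` does not depend on it). -/
def IsGeometricMean {m : ℕ} (φ : Circle → Mat m) (g : ℂ) : Prop :=
  ∃ L : Circle → ℂ, Continuous L ∧ (∀ t, Complex.exp (L t) = (φ t).det) ∧
    g = Complex.exp ((1 / (2 * (Real.pi : ℂ))) *
      ∫ θ in (0 : ℝ)..(2 * Real.pi), L (Circle.exp θ))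

/-! ### Trace class operators and Fredholm determinants -/

universe u

variable {E : Type u} [NormedAddCommGroup E] [InnerProductSpace ℂ E]

/-- Trace class (nuclear) operators: `A f = ∑ ⟨x_k, f⟩ y_k` with `∑ ‖x_k‖ ‖y_k‖ < ∞`. -/
def IsTraceClass (A : E →L[ℂ] E) : Prop :=
  ∃ x y : ℕ → E, Summable (fun k => ‖x k‖ * ‖y k‖) ∧
    ∀ f, HasSum (fun k => inner ℂ (x k) f • y k) (A f)

open Classical in
/-- `d` is the Fredholm determinant of the operator `T`: `T - I` is of trace class, and in every
orthonormal basis the determinants of the finite sections of `T` converge to `d`. -/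
def HasFredholmDet (T : E →L[ℂ] E) (d : ℂ) : Prop :=
  IsTraceClass (T - 1) ∧
    ∀ (ι : Type u) (e : HilbertBasis ι ℂ E),
      Tendsto (fun S : Finset ι =>
        (Matrix.of fun i j : S => inner ℂ (e i) (T (e j))).det) atTop (𝓝 d)

lemma HasFredholmDet.unique [CompleteSpace E] {T : E →L[ℂ] E} {d d' : ℂ}
    (h : HasFredholmDet T d) (h' : HasFredholmDet T d') : d = d' := by
  obtain ⟨w, e, _⟩ := exists_hilbertBasis ℂ E
  exact tendsto_nhds_unique (h.2 w e) (h'.2 w e)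

end ModelBO

end

/-!
The factorization `a = v₊ v₋ = w₋ w₊` turns into the operator identity
`T(a) = T(v₊) (I - H(b) H(c̃))⁻¹ T(v₋)` on `H²`. Since `T(v₋)` leaves `K_u` invariant and `T(v₊)`
leaves its complement invariant, compressing to `K_u` gives
`det T_u(a) = det T_u(v₊) · det (P_u (I - H(b) H(c̃))⁻¹ | K_u) · det T_u(v₋)`.
By Jacobi's identity for complementary minors the middle factor is the quotient of the two Fredholm
determinants. In the Takenaka–Malmquist basis of `K_u` the outer factors are block triangular, with
the values at `α ∈ σ(u)` of the holomorphic extensions of `v₊` and of `v₋^*` (conjugated back) as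
diagonal blocks; the mean value property applied to a logarithm of `det v₊` and of `det v₋` on the
disc identifies the product of the determinants of these values with `G(a ∘ μ_{-α})`.
-/

noncomputable section

namespace ModelBO

/-! ### Hadamard's inequality -/

section Hadamard

variable {n 𝕜 : Type*} [Fintype n] [DecidableEq n] [RCLike 𝕜]

open scoped ComplexOrder in
lemma prod_eigenvalues_le_exp {A : Matrix n n 𝕜} (hA : A.PosSemidef) :
    ∏ i, hA.isHermitian.eigenvalues i ≤
      Real.exp (∑ i, (hA.isHermitian.eigenvalues i - 1)) := by
  rw [Real.exp_sum]
  exact Finset.prod_le_prod (fun i _ => hA.eigenvalues_nonneg i)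
    fun i _ => by linarith [Real.add_one_le_exp (hA.isHermitian.eigenvalues i - 1)]

open scoped ComplexOrder in
lemma norm_det_le_one_of_sum_norm_sq_le_one (M : Matrix n n 𝕜)
    (h : ∀ j, ∑ i, ‖M i j‖ ^ 2 ≤ 1) : ‖M.det‖ ≤ 1 := by
  have hM : (M.conjTranspose * M).PosSemidef := Matrix.posSemidef_conjTranspose_mul_self M
  have hdet : ∏ i, hM.isHermitian.eigenvalues i = ‖M.det‖ ^ 2 := by
    have := hM.isHermitian.det_eq_prod_eigenvalues
    rw [Matrix.det_mul, Matrix.det_conjTranspose, RCLike.star_def, RCLike.conj_mul] at this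
    exact_mod_cast this.symm
  have htr : ∑ i, hM.isHermitian.eigenvalues i = ∑ j, ∑ i, ‖M i j‖ ^ 2 := by
    have := hM.isHermitian.trace_eq_sum_eigenvalues
    simp only [Matrix.trace, Matrix.diag, Matrix.mul_apply, Matrix.conjTranspose_apply,
      RCLike.star_def, RCLike.conj_mul] at this
    exact_mod_cast this.symm
  have hle : ∑ i, (hM.isHermitian.eigenvalues i - 1) ≤ 0 := by
    rw [Finset.sum_sub_distrib, htr, ← Finset.sum_sub_distrib]
    exact Finset.sum_nonpos fun j _ => by linarith [h j]
  refine (sq_le_one_iff₀ (norm_nonneg _)).mp ?_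
  rw [← hdet]
  exact (prod_eigenvalues_le_exp hM).trans (Real.exp_le_one_iff.mpr hle)

variable {E : Type*} [NormedAddCommGroup E] [InnerProductSpace 𝕜 E]

lemma norm_det_inner_le_one_of_orthonormalBasis (b : OrthonormalBasis n 𝕜 E) {x y : n → E}
    (hx : ∀ i, ‖x i‖ ≤ 1) (hy : ∀ i, ‖y i‖ ≤ 1) :
    ‖(Matrix.of fun i j => inner 𝕜 (x i) (y j)).det‖ ≤ 1 := by
  have coord_le : ∀ z : n → E, (∀ i, ‖z i‖ ≤ 1) →
      ‖(Matrix.of fun k i => inner 𝕜 (b k) (z i)).det‖ ≤ 1 := fun z hz =>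
    norm_det_le_one_of_sum_norm_sq_le_one _ fun j =>
      (b.sum_sq_norm_inner_right (z j)).trans_le (pow_le_one₀ (norm_nonneg _) (hz j))
  have hmul : (Matrix.of fun i j => inner 𝕜 (x i) (y j)) =
      (Matrix.of fun k i => inner 𝕜 (b k) (x i)).conjTranspose *
        (Matrix.of fun k j => inner 𝕜 (b k) (y j)) := by
    ext i j
    simp [Matrix.mul_apply, b.sum_inner_mul_inner]
  rw [hmul, Matrix.det_mul, Matrix.det_conjTranspose, norm_mul, norm_star]
  exact mul_le_one₀ (coord_le x hx) (norm_nonneg _) (coord_le y hy)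

lemma det_inner_eq_zero_of_not_linearIndependent {x : n → E} (y : n → E)
    (hx : ¬ LinearIndependent 𝕜 x) : (Matrix.of fun i j => inner 𝕜 (x i) (y j)).det = 0 := by
  obtain ⟨g, hg, i, hi⟩ := Fintype.not_linearIndependent_iff.mp hx
  rw [← Matrix.exists_vecMul_eq_zero_iff]
  refine ⟨fun i => conj (g i), fun h => hi (by simpa using congrFun h i), ?_⟩
  ext j
  simp only [Matrix.vecMul, dotProduct, Matrix.of_apply, Pi.zero_apply, ← inner_smul_left]
  rw [← sum_inner, hg, inner_zero_left]

lemma norm_det_inner_le_one {x y : n → E} (hx : ∀ i, ‖x i‖ ≤ 1) (hy : ∀ i, ‖y i‖ ≤ 1) :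
    ‖(Matrix.of fun i j => inner 𝕜 (x i) (y j)).det‖ ≤ 1 := by
  by_cases hli : LinearIndependent 𝕜 x
  · let W : Submodule 𝕜 E := Submodule.span 𝕜 (Set.range x)
    have : FiniteDimensional 𝕜 W := FiniteDimensional.span_of_finite 𝕜 (Set.finite_range x)
    let b : OrthonormalBasis n 𝕜 W := (stdOrthonormalBasis 𝕜 W).reindex
      ((finCongr (finrank_span_eq_card hli)).trans (Fintype.equivFin n).symm)
    let x' : n → W := fun i => ⟨x i, Submodule.subset_span ⟨i, rfl⟩⟩
    have hproj : ∀ i j, inner 𝕜 (x i) (y j) = inner 𝕜 (x' i) (W.orthogonalProjectionOnto (y j)) :=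
      fun i j => (W.inner_orthogonalProjectionOnto_eq_of_mem_left (x' i) (y j)).symm
    simp only [hproj]
    exact norm_det_inner_le_one_of_orthonormalBasis b hx fun j =>
      (W.norm_orthogonalProjectionOnto_apply_le _).trans (hy j)
  · rw [det_inner_eq_zero_of_not_linearIndependent y hli, norm_zero]
    exact zero_le_one

lemma norm_det_inner_le (x y : n → E) :
    ‖(Matrix.of fun i j => inner 𝕜 (x i) (y j)).det‖ ≤ ∏ i, (‖x i‖ * ‖y i‖) := by
  let unit (z : E) : E := ((‖z‖⁻¹ : ℝ) : 𝕜) • z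
  have smul_unit : ∀ z : E, ((‖z‖ : ℝ) : 𝕜) • unit z = z := fun z => by
    rcases eq_or_ne z 0 with rfl | hz
    · simp
    · rw [smul_smul, ← RCLike.ofReal_mul, mul_inv_cancel₀ (norm_ne_zero_iff.mpr hz),
        RCLike.ofReal_one, one_smul]
  have norm_unit_le : ∀ z : E, ‖unit z‖ ≤ 1 := fun z => by
    rw [norm_smul, RCLike.norm_ofReal, abs_inv, abs_norm]
    exact inv_mul_le_one_of_le₀ le_rfl (norm_nonneg _)
  have hscale : (Matrix.of fun i j => inner 𝕜 (x i) (y j)) =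
      Matrix.of fun i j => ((‖x i‖ : ℝ) : 𝕜) * (Matrix.of fun i j => ((‖y j‖ : ℝ) : 𝕜) *
        (Matrix.of fun i j => inner 𝕜 (unit (x i)) (unit (y j))) i j) i j := by
    ext i j
    simp only [Matrix.of_apply]
    conv_lhs => rw [← smul_unit (x i), ← smul_unit (y j), inner_smul_left, inner_smul_right,
      RCLike.conj_ofReal]
  rw [hscale, Matrix.det_mul_column, Matrix.det_mul_row, norm_mul, norm_mul, ← mul_assoc,
    Finset.prod_mul_distrib]
  simp only [norm_prod, RCLike.norm_ofReal, abs_norm]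
  exact mul_le_of_le_one_right (by positivity)
    (norm_det_inner_le_one (fun i => norm_unit_le _) fun i => norm_unit_le _)

end Hadamard

section FredholmDeterminant

universe u

variable {E : Type u} [NormedAddCommGroup E] [InnerProductSpace ℂ E]

/-! ### Fredholm series -/

open Classical in
/-- The Fredholm series `∑_T det (⟨x_k, y_l⟩)_{k, l ∈ T}` over all finite sets `T` of indices. It is
the Fredholm determinant of `I + ∑ ⟨x_k, ·⟩ y_k`, written without reference to a basis. -/
def fredholmSeries {κ : Type*} (x y : κ → E) : ℂ :=
  ∑' T : Finset κ, (Matrix.of fun k l : T => inner ℂ (x k) (y l)).det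

open Classical in
lemma norm_det_inner_finset_le {κ : Type*} (x y : κ → E) (T : Finset κ) :
    ‖(Matrix.of fun k l : T => inner ℂ (x k) (y l)).det‖ ≤ ∏ k ∈ T, (‖x k‖ * ‖y k‖) :=
  (norm_det_inner_le (fun k : T => x k) (fun k : T => y k)).trans_eq
    (Finset.prod_coe_sort T fun k => ‖x k‖ * ‖y k‖)

lemma tendsto_det {n β : Type*} [Fintype n] [DecidableEq n] {l : Filter β} {M : β → Matrix n n ℂ}
    {M' : Matrix n n ℂ} (h : ∀ i j, Tendsto (fun b => M b i j) l (𝓝 (M' i j))) :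
    Tendsto (fun b => (M b).det) l (𝓝 M'.det) :=
  (continuous_id.matrix_det.tendsto _).comp
    (tendsto_pi_nhds.mpr fun i => tendsto_pi_nhds.mpr fun j => h i j)

lemma tendsto_fredholmSeries {κ β : Type*} {l : Filter β} {xs : β → κ → E} {x y : κ → E}
    {X : κ → ℝ} (hX : ∀ b k, ‖xs b k‖ ≤ X k) (hXy : Summable fun k => X k * ‖y k‖)
    (hx : ∀ k, Tendsto (fun b => xs b k) l (𝓝 (x k))) :
    Tendsto (fun b => fredholmSeries (xs b) y) l (𝓝 (fredholmSeries x y)) := by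
  classical
  rcases isEmpty_or_nonempty β with hβ | ⟨⟨b₀⟩⟩
  · rw [Subsingleton.elim l ⊥]
    exact tendsto_bot
  have hX0 : ∀ k, 0 ≤ X k := fun k => (norm_nonneg _).trans (hX b₀ k)
  refine tendsto_tsum_of_dominated_convergence (summable_finsetProd_of_summable_nonneg
    (fun k => mul_nonneg (hX0 k) (norm_nonneg _)) hXy) ?_ ?_
  · exact fun T => tendsto_det fun k j => (hx k).inner tendsto_const_nhds
  · refine Eventually.of_forall fun b T => (norm_det_inner_finset_le _ _ T).trans ?_
    exact Finset.prod_le_prod (fun k _ => by positivity) fun k _ =>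
      mul_le_mul_of_nonneg_right (hX b k) (norm_nonneg _)

lemma det_one_add_eq_sum_minors {n R : Type*} [Fintype n] [DecidableEq n] [CommRing R]
    (M : Matrix n n R) :
    (1 + M).det =
      ∑ s : Finset n, (M.submatrix (Subtype.val : s → n) (Subtype.val : s → n)).det := by
  rw [add_comm]
  refine (Matrix.detRowAlternating.map_add_univ M.row (1 : Matrix n n R).row).trans ?_
  exact Finset.sum_congr rfl fun s _ => Matrix.det_piecewise_one_eq_submatrix_det M s

lemma fredholmSeries_fintype {κ : Type*} [Fintype κ] [DecidableEq κ] (x y : κ → E) :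
    fredholmSeries x y = (1 + Matrix.of fun k l => inner ℂ (x k) (y l)).det := by
  rw [fredholmSeries, tsum_fintype, det_one_add_eq_sum_minors]
  refine Finset.sum_congr rfl fun s _ => ?_
  congr!

lemma fredholmSeries_restrict {κ : Type*} (x y : κ → E) (F : Finset κ) (hF : ∀ k ∉ F, x k = 0) :
    fredholmSeries (fun k : F => x k) (fun k : F => y k) = fredholmSeries x y := by
  classical
  have hinj : Function.Injective (fun T : Finset F => T.map (Function.Embedding.subtype _)) :=
    Finset.map_injective _
  rw [fredholmSeries, fredholmSeries]
  refine Eq.trans (tsum_congr fun T => ?_) (hinj.tsum_eq fun T hT => ?_)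
  · rw [← Matrix.det_submatrix_equiv_self (Finset.equivMap (Function.Embedding.subtype _) T)]
    congr!
  · have hTF : T ⊆ F := fun k hk => by
      by_contra hkF
      refine hT (Matrix.det_eq_zero_of_row_eq_zero (⟨k, hk⟩ : T) fun j => ?_)
      simp [hF k hkF]
    exact ⟨T.subtype (· ∈ F), (Finset.subtype_map _).trans (Finset.filter_true_of_mem hTF)⟩

/-! ### Nuclear representations -/

/-- `K = ∑ ⟨x_k, ·⟩ y_k` with `∑ ‖x_k‖ ‖y_k‖ < ∞`, over an arbitrary index type. It records the
vectors which witness that `K` is of trace class. -/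
structure IsNuclearRep {κ : Type*} (x y : κ → E) (K : E →L[ℂ] E) : Prop where
  summable : Summable fun k => ‖x k‖ * ‖y k‖
  hasSum : ∀ f, HasSum (fun k => inner ℂ (x k) f • y k) (K f)

lemma IsTraceClass.exists_isNuclearRep {K : E →L[ℂ] E} (hK : IsTraceClass K) :
    ∃ x y : ℕ → E, IsNuclearRep x y K :=
  let ⟨x, y, hxy, hsum⟩ := hK
  ⟨x, y, hxy, hsum⟩

namespace IsNuclearRep

variable {κ κ' : Type*} {x y : κ → E} {x' y' : κ' → E} {K L : E →L[ℂ] E}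

lemma isTraceClass [Countable κ] (hK : IsNuclearRep x y K) : IsTraceClass K := by
  obtain ⟨φ, hφ⟩ := Countable.exists_injective_nat κ
  refine ⟨Function.extend φ x 0, Function.extend φ y 0, ?_, fun f => ?_⟩
  · rw [← hφ.summable_iff fun k hk => by simp [Function.extend_apply' _ _ _ hk]]
    simpa only [Function.comp_def, hφ.extend_apply] using hK.summable
  · rw [← hφ.hasSum_iff fun k hk => by simp [Function.extend_apply' _ _ _ hk]]
    simpa only [Function.comp_def, hφ.extend_apply] using hK.hasSum f

lemma add (hK : IsNuclearRep x y K) (hL : IsNuclearRep x' y' L) :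
    IsNuclearRep (Sum.elim x x') (Sum.elim y y') (K + L) where
  summable := Summable.sum _ hK.summable hL.summable
  hasSum f := HasSum.sum (M := E) (hK.hasSum f) (hL.hasSum f)

lemma comp_left (hK : IsNuclearRep x y K) (M : E →L[ℂ] E) :
    IsNuclearRep x (fun k => M (y k)) (M ∘L K) where
  summable := by
    refine .of_nonneg_of_le (fun k => by positivity) (fun k => ?_) (hK.summable.mul_left ‖M‖)
    rw [mul_left_comm]
    gcongr
    exact M.le_opNorm _
  hasSum f := by simpa using M.hasSum (hK.hasSum f)

lemma comp_right [CompleteSpace E] (hK : IsNuclearRep x y K) (M : E →L[ℂ] E) :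
    IsNuclearRep (fun k => M.adjoint (x k)) y (K ∘L M) where
  summable := by
    refine .of_nonneg_of_le (fun k => by positivity) (fun k => ?_)
      (hK.summable.mul_left ‖M.adjoint‖)
    rw [← mul_assoc]
    gcongr
    exact M.adjoint.le_opNorm _
  hasSum f := by simpa [ContinuousLinearMap.adjoint_inner_left] using hK.hasSum (M f)

end IsNuclearRep

lemma IsTraceClass.comp_left {K : E →L[ℂ] E} (hK : IsTraceClass K) (M : E →L[ℂ] E) :
    IsTraceClass (M ∘L K) :=
  let ⟨_, _, h⟩ := hK.exists_isNuclearRep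
  (h.comp_left M).isTraceClass

lemma IsTraceClass.comp_right [CompleteSpace E] {K : E →L[ℂ] E} (hK : IsTraceClass K)
    (M : E →L[ℂ] E) : IsTraceClass (K ∘L M) :=
  let ⟨_, _, h⟩ := hK.exists_isNuclearRep
  (h.comp_right M).isTraceClass

lemma isTraceClass_neg_iff {K : E →L[ℂ] E} : IsTraceClass (-K) ↔ IsTraceClass K := by
  have neg : ∀ {K : E →L[ℂ] E}, IsTraceClass K → IsTraceClass (-K) := fun hK => by
    simpa using! hK.comp_left (-1)
  exact ⟨fun h => by simpa using! neg h, neg⟩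

/-! ### Finite sections -/

variable {ι : Type*}

/-- The matrix of the compression of `T` to the span of the vectors `e i`, `i ∈ S`. -/
def finiteSection (e : ι → E) (S : Finset ι) (T : E →L[ℂ] E) : Matrix S S ℂ :=
  Matrix.of fun i j => inner ℂ (e i) (T (e j))

/-- The orthogonal projection onto the span of the vectors `e i`, `i ∈ S`, of an orthonormal
family, through which products of finite sections are compared with sections of products. -/
def sectionProj (e : ι → E) (S : Finset ι) : E →L[ℂ] E :=
  ∑ i ∈ S, (innerSL ℂ (e i)).smulRight (e i)

lemma sectionProj_apply (e : ι → E) (S : Finset ι) (z : E) :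
    sectionProj e S z = ∑ i ∈ S, inner ℂ (e i) z • e i := by
  simp [sectionProj]

lemma inner_sectionProj_left (e : ι → E) (S : Finset ι) (x y : E) :
    inner ℂ (sectionProj e S x) y = ∑ i ∈ S, inner ℂ x (e i) * inner ℂ (e i) y := by
  simp only [sectionProj_apply, sum_inner, inner_smul_left, inner_conj_symm]

lemma inner_sectionProj_right (e : ι → E) (S : Finset ι) (x y : E) :
    inner ℂ x (sectionProj e S y) = ∑ i ∈ S, inner ℂ x (e i) * inner ℂ (e i) y := by
  simp only [sectionProj_apply, inner_sum, inner_smul_right, mul_comm]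

lemma adjoint_sectionProj [CompleteSpace E] (e : ι → E) (S : Finset ι) :
    (sectionProj e S).adjoint = sectionProj e S :=
  ((ContinuousLinearMap.eq_adjoint_iff _ _).mpr fun x y => by
    rw [inner_sectionProj_left, inner_sectionProj_right]).symm

lemma sectionProj_apply_of_mem {e : ι → E} (he : Orthonormal ℂ e) {S : Finset ι} {i : ι}
    (hi : i ∈ S) : sectionProj e S (e i) = e i := by
  classical
  simp [sectionProj_apply, orthonormal_iff_ite.mp he, hi]

lemma inner_sectionProj_of_mem {e : ι → E} (he : Orthonormal ℂ e) {S : Finset ι} {i : ι}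
    (hi : i ∈ S) (z : E) : inner ℂ (e i) (sectionProj e S z) = inner ℂ (e i) z := by
  classical
  simp [inner_sectionProj_right, orthonormal_iff_ite.mp he, hi]

lemma norm_sectionProj_le {e : ι → E} (he : Orthonormal ℂ e) (S : Finset ι) (z : E) :
    ‖sectionProj e S z‖ ≤ ‖z‖ := by
  have h : ‖sectionProj e S z‖ ^ 2 = ∑ i ∈ S, ‖inner ℂ (e i) z‖ ^ 2 := by
    rw [sectionProj_apply, ← inner_self_eq_norm_sq (𝕜 := ℂ), he.inner_sum]
    simp only [Complex.conj_mul', ← Complex.ofReal_pow, ← Complex.ofReal_sum]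
    rfl
  exact (sq_le_sq₀ (norm_nonneg _) (norm_nonneg _)).mp (h.trans_le (he.sum_inner_products_le z))

lemma tendsto_sectionProj (e : HilbertBasis ι ℂ E) (z : E) :
    Tendsto (fun S => sectionProj e S z) atTop (𝓝 z) := by
  simp_rw [sectionProj_apply, ← e.repr_apply_apply]
  exact e.hasSum_repr z

lemma tendsto_sectionProj_map_sectionProj (e : HilbertBasis ι ℂ E) (M : E →L[ℂ] E) (z : E) :
    Tendsto (fun S => sectionProj e S (M (sectionProj e S z))) atTop (𝓝 (M z)) := by
  have hM : Tendsto (fun S => M (sectionProj e S z) - M z) atTop (𝓝 0) :=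
    tendsto_sub_nhds_zero_iff.mpr ((M.continuous.tendsto _).comp (tendsto_sectionProj e z))
  have hsub : Tendsto (fun S => sectionProj e S (M (sectionProj e S z) - M z)) atTop (𝓝 0) :=
    squeeze_zero_norm (fun S => norm_sectionProj_le e.orthonormal S _)
      (tendsto_zero_iff_norm_tendsto_zero.mp hM)
  simpa using hsub.add (tendsto_sectionProj e (M z))

variable {κ κ' : Type*} {x y : κ → E} {x' y' : κ' → E} {K L : E →L[ℂ] E}

open Classical in
lemma fredholmSeries_sectionProj_fintype [Fintype κ] {e : ι → E} (he : Orthonormal ℂ e)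
    (S : Finset ι) (x y : κ → E) :
    fredholmSeries (fun k => sectionProj e S (x k)) y =
      (Matrix.of fun i j : S =>
        inner ℂ (e i) (e j) + ∑ k, inner ℂ (e i) (y k) * inner ℂ (x k) (e j)).det := by
  have hmul : (Matrix.of fun k l => inner ℂ (sectionProj e S (x k)) (y l)) =
      (Matrix.of fun (k : κ) (j : S) => inner ℂ (x k) (e j)) *
        (Matrix.of fun (i : S) (k : κ) => inner ℂ (e i) (y k)) := by
    ext k l
    simp only [Matrix.mul_apply, Matrix.of_apply, inner_sectionProj_left]
    exact (Finset.sum_coe_sort S (fun i => inner ℂ (x k) (e i) * inner ℂ (e i) (y l))).symm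
  rw [fredholmSeries_fintype, hmul, Matrix.det_one_add_mul_comm]
  congr 1
  ext i j
  simp [Matrix.mul_apply, orthonormal_iff_ite.mp he, Matrix.one_apply]

open Classical in
lemma IsNuclearRep.det_finiteSection (hK : IsNuclearRep x y K) {e : ι → E}
    (he : Orthonormal ℂ e) (S : Finset ι) :
    (finiteSection e S (1 + K)).det = fredholmSeries (fun k => sectionProj e S (x k)) y := by
  let trunc (F : Finset κ) (k : κ) : E := if k ∈ F then sectionProj e S (x k) else 0
  have hseries : Tendsto (fun F => fredholmSeries (trunc F) y) atTop
      (𝓝 (fredholmSeries (fun k => sectionProj e S (x k)) y)) := by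
    refine tendsto_fredholmSeries (X := fun k => ‖x k‖) (fun F k => ?_) hK.summable
      fun k => ?_
    · by_cases hk : k ∈ F
      · simpa [trunc, hk] using norm_sectionProj_le he S (x k)
      · simp [trunc, hk]
    · refine tendsto_const_nhds.congr' ?_
      filter_upwards [eventually_ge_atTop {k}] with F hF
      simp [trunc, Finset.singleton_subset_iff.mp hF]
  have hdet : ∀ F, fredholmSeries (trunc F) y = (Matrix.of fun i j : S =>
      inner ℂ (e i) (e j) + ∑ k ∈ F, inner ℂ (e i) (y k) * inner ℂ (x k) (e j)).det := by
    intro F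
    simp only [← fredholmSeries_restrict (trunc F) y F fun _ hk => if_neg hk, trunc,
      Finset.coe_mem, if_true, fredholmSeries_sectionProj_fintype he]
    congr! 5 with i j
    exact Finset.sum_coe_sort F fun k => inner ℂ (e i) (y k) * inner ℂ (x k) (e j)
  have hentry : ∀ i j : S, Tendsto (fun F : Finset κ =>
      inner ℂ (e i) (e j) + ∑ k ∈ F, inner ℂ (e i) (y k) * inner ℂ (x k) (e j)) atTop
      (𝓝 (finiteSection e S (1 + K) i j)) := fun i j => by
    have hsum := (innerSL ℂ (e i)).hasSum (hK.hasSum (e j))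
    simp only [map_smul, innerSL_apply_apply, smul_eq_mul, mul_comm (inner ℂ (x _) _)] at hsum
    rw [finiteSection, Matrix.of_apply, add_apply, inner_add_right]
    exact tendsto_const_nhds.add hsum
  refine tendsto_nhds_unique ?_ hseries
  simp_rw [hdet]
  exact tendsto_det hentry

lemma IsNuclearRep.hasFredholmDet [Countable κ] (hK : IsNuclearRep x y K) :
    HasFredholmDet (1 + K) (fredholmSeries x y) := by
  refine ⟨by rw [add_sub_cancel_left]; exact hK.isTraceClass, fun ι e => ?_⟩
  refine (tendsto_fredholmSeries (fun S k => norm_sectionProj_le e.orthonormal S (x k))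
    hK.summable fun k => tendsto_sectionProj e (x k)).congr fun S => ?_
  rw [← hK.det_finiteSection e.orthonormal S, finiteSection]

lemma exists_hasFredholmDet {T : E →L[ℂ] E} (hT : IsTraceClass (T - 1)) :
    ∃ d, HasFredholmDet T d := by
  obtain ⟨x, y, hxy⟩ := hT.exists_isNuclearRep
  exact ⟨_, add_sub_cancel 1 T ▸ hxy.hasFredholmDet⟩

lemma exists_hasFredholmDet_one_sub {K : E →L[ℂ] E} (hK : IsTraceClass K) :
    ∃ d, HasFredholmDet (1 - K) d :=
  exists_hasFredholmDet (by rwa [sub_sub_cancel_left, isTraceClass_neg_iff])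

lemma hasFredholmDet_one : HasFredholmDet (1 : E →L[ℂ] E) 1 := by
  have h : IsNuclearRep (fun k : Empty => k.elim) (fun k => k.elim) (0 : E →L[ℂ] E) :=
    ⟨summable_empty, fun _ => hasSum_empty⟩
  simpa [fredholmSeries_fintype] using h.hasFredholmDet

/-! ### Multiplicativity -/

lemma finiteSection_mul {e : ι → E} (he : Orthonormal ℂ e) (S : Finset ι) (K L : E →L[ℂ] E) :
    finiteSection e S (1 + K) * finiteSection e S (1 + L) =
      finiteSection e S (1 + (K + L + K ∘L sectionProj e S ∘L L)) := by
  ext i l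
  have hsum : ∑ j : S, inner ℂ (e i) ((1 + K) (e j)) * inner ℂ (e j) ((1 + L) (e l)) =
      inner ℂ (e i) ((1 + K) (sectionProj e S ((1 + L) (e l)))) := by
    rw [sectionProj_apply, map_sum, inner_sum, ← Finset.sum_coe_sort S]
    exact Finset.sum_congr rfl fun j _ => by rw [map_smul, inner_smul_right, mul_comm]
  simp only [finiteSection, Matrix.mul_apply, Matrix.of_apply, hsum]
  simp only [add_apply, one_apply_eq_self, map_add, ContinuousLinearMap.comp_apply,
    inner_add_right, inner_sectionProj_of_mem he i.2, sectionProj_apply_of_mem he l.2]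
  ring

variable [CompleteSpace E]

open Classical in
lemma IsNuclearRep.det_finiteSection_mul (hK : IsNuclearRep x y K) (hL : IsNuclearRep x' y' L)
    {e : ι → E} (he : Orthonormal ℂ e) (S : Finset ι) :
    (finiteSection e S (1 + K)).det * (finiteSection e S (1 + L)).det =
      fredholmSeries (Sum.elim (Sum.elim (fun k => sectionProj e S (x k))
          fun k => sectionProj e S (x' k))
        fun k => sectionProj e S (L.adjoint (sectionProj e S (x k))))
        (Sum.elim (Sum.elim y y') y) := by
  have hmid := hK.comp_right (sectionProj e S ∘L L)
  simp only [ContinuousLinearMap.adjoint_comp, adjoint_sectionProj,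
    ContinuousLinearMap.comp_apply] at hmid
  rw [← Matrix.det_mul, finiteSection_mul he, ((hK.add hL).add hmid).det_finiteSection he S]
  congr 1
  funext k
  rcases k with (k | k) | k <;> rfl

open Classical in
lemma IsNuclearRep.tendsto_det_finiteSection_mul (hK : IsNuclearRep x y K)
    (hL : IsNuclearRep x' y' L) (e : HilbertBasis ι ℂ E) :
    Tendsto (fun S => (finiteSection e S (1 + K)).det * (finiteSection e S (1 + L)).det) atTop
      (𝓝 (fredholmSeries (Sum.elim (Sum.elim x x') fun k => L.adjoint (x k))
        (Sum.elim (Sum.elim y y') y))) := by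
  simp_rw [hK.det_finiteSection_mul hL e.orthonormal]
  refine tendsto_fredholmSeries
    (X := Sum.elim (Sum.elim (fun k => ‖x k‖) fun k => ‖x' k‖) fun k => ‖L.adjoint‖ * ‖x k‖)
    ?_ ?_ ?_
  · rintro S ((k | k) | k)
    · exact norm_sectionProj_le e.orthonormal S _
    · exact norm_sectionProj_le e.orthonormal S _
    · refine (norm_sectionProj_le e.orthonormal S _).trans ((L.adjoint.le_opNorm _).trans ?_)
      exact mul_le_mul_of_nonneg_left (norm_sectionProj_le e.orthonormal S _) (norm_nonneg _)
  · refine Summable.sum _ (Summable.sum _ hK.summable hL.summable) ?_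
    simpa [Function.comp_def, mul_assoc] using hK.summable.mul_left ‖L.adjoint‖
  · rintro ((k | k) | k)
    · exact tendsto_sectionProj e _
    · exact tendsto_sectionProj e _
    · exact tendsto_sectionProj_map_sectionProj e L.adjoint (x k)

theorem HasFredholmDet.mul {A B : E →L[ℂ] E} {d d' : ℂ} (hA : HasFredholmDet A d)
    (hB : HasFredholmDet B d') : HasFredholmDet (A * B) (d * d') := by
  obtain ⟨x, y, hK⟩ := hA.1.exists_isNuclearRep
  obtain ⟨x', y', hL⟩ := hB.1.exists_isNuclearRep
  obtain ⟨ι, e, _⟩ := exists_hilbertBasis ℂ E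
  have hlim := hK.tendsto_det_finiteSection_mul hL e
  rw [add_sub_cancel, add_sub_cancel] at hlim
  have hAB : 1 + (A - 1 + (B - 1) + (A - 1) * (B - 1)) = A * B := by noncomm_ring
  rw [tendsto_nhds_unique ((hA.2 ι e).mul (hB.2 ι e)) hlim, ← hAB]
  exact ((hK.add hL).add (hK.comp_right (B - 1))).hasFredholmDet

end FredholmDeterminant

/-! ### Jacobi's identity for complementary minors -/

section Jacobi

universe u

variable {E : Type u} [NormedAddCommGroup E] [InnerProductSpace ℂ E]

/-- The compression of the operator `T` to the subspace `W`. -/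
def compression (W : Submodule ℂ E) [W.HasOrthogonalProjection] (T : E →L[ℂ] E) : W →L[ℂ] W :=
  W.orthogonalProjectionOnto ∘L T ∘L W.subtypeL

variable (W : Submodule ℂ E)

lemma isNuclearRep_starProjection {n : Type*} [Fintype n] [W.HasOrthogonalProjection]
    (b : OrthonormalBasis n ℂ W) :
    IsNuclearRep (fun k => (b k : E)) (fun k => (b k : E)) W.starProjection where
  summable := (hasSum_fintype _).summable
  hasSum f := by
    have hf : W.starProjection f = ∑ k, inner ℂ (b k : E) f • (b k : E) := by
      simpa [b.repr_apply_apply, W.inner_orthogonalProjectionOnto_eq_of_mem_left] using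
        congrArg (Subtype.val) (b.sum_repr (W.orthogonalProjectionOnto f)).symm
    exact hf ▸ hasSum_fintype _

lemma det_compression {n : Type*} [Fintype n] [DecidableEq n] [W.HasOrthogonalProjection]
    (b : OrthonormalBasis n ℂ W) (T : E →L[ℂ] E) :
    LinearMap.det (compression W T).toLinearMap =
      (Matrix.of fun k l => inner ℂ (b k : E) (T (b l))).det := by
  rw [← LinearMap.det_toMatrix b.toBasis]
  congr 1
  ext k l
  simp [LinearMap.toMatrix_apply, compression, b.repr_apply_apply]

variable [FiniteDimensional ℂ W]

lemma det_compression_one_add {n : Type*} [Fintype n] [DecidableEq n]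
    (b : OrthonormalBasis n ℂ W) (T : E →L[ℂ] E) :
    LinearMap.det (compression W (1 + T)).toLinearMap =
      (1 + Matrix.of fun k l => inner ℂ (b k : E) (T (b l))).det := by
  rw [det_compression W b]
  congr 1
  ext k l
  simp [← Submodule.coe_inner, orthonormal_iff_ite.mp b.orthonormal,
    Matrix.one_apply]

lemma hasFredholmDet_one_add_mul_starProjection (T : E →L[ℂ] E) :
    HasFredholmDet (1 + T * W.starProjection)
      (LinearMap.det (compression W (1 + T)).toLinearMap) := by
  have hrep := (isNuclearRep_starProjection W (stdOrthonormalBasis ℂ W)).comp_left T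
  rw [det_compression_one_add W (stdOrthonormalBasis ℂ W), ← fredholmSeries_fintype]
  exact hrep.hasFredholmDet

variable [CompleteSpace E]

lemma hasFredholmDet_one_add_starProjection_mul (T : E →L[ℂ] E) :
    HasFredholmDet (1 + W.starProjection * T)
      (LinearMap.det (compression W (1 + T)).toLinearMap) := by
  have hrep := (isNuclearRep_starProjection W (stdOrthonormalBasis ℂ W)).comp_right T
  rw [det_compression_one_add W (stdOrthonormalBasis ℂ W)]
  simp only [← ContinuousLinearMap.adjoint_inner_left]
  rw [← fredholmSeries_fintype]
  exact hrep.hasFredholmDet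

lemma HasFredholmDet.ne_zero {A : (E →L[ℂ] E)ˣ} {d : ℂ} (hd : HasFredholmDet (A : E →L[ℂ] E) d) :
    d ≠ 0 := by
  have htr : IsTraceClass ((↑A⁻¹ : E →L[ℂ] E) - 1) := by
    have hmul : (↑A⁻¹ : E →L[ℂ] E) - 1 = -↑A⁻¹ * (↑A - 1) := by
      rw [mul_sub, neg_mul, A.inv_mul, neg_mul, mul_one]
      abel
    exact hmul ▸ hd.1.comp_left _
  obtain ⟨d', hd'⟩ := exists_hasFredholmDet htr
  have hdd' : d * d' = 1 :=
    (hd.mul hd').unique (by rw [Units.mul_inv]; exact hasFredholmDet_one)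
  exact left_ne_zero_of_mul_eq_one hdd'

/-- Both sides are `1 - Q (1 - A)` with `Q = 1 - P`. -/
lemma jacobi_factorization {R : Type*} [Ring R] (A : Rˣ) {P : R} (hP : IsIdempotentElem P) :
    (1 + P * (↑A⁻¹ - 1)) * A =
      (1 + -((1 - P) * (1 - A)) * P) * (1 - (1 - P) * (1 - A) * (1 - P)) := by
  have hPQ : P * (1 - P) = 0 := hP.mul_one_sub_self
  set X := (1 - P) * (1 - A) * P with hX
  set Y := (1 - P) * (1 - A) * (1 - P) with hY
  have hXY : X * Y = 0 := by
    calc X * Y = (1 - P) * (1 - A) * (P * (1 - P)) * ((1 - A) * (1 - P)) := by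
          simp only [hX, hY, mul_assoc]
      _ = 0 := by rw [hPQ, mul_zero, zero_mul]
  calc (1 + P * (↑A⁻¹ - 1)) * A
      = A + P * (↑A⁻¹ * A - A) := by noncomm_ring
    _ = 1 - (1 - P) * (1 - A) * (P + (1 - P)) := by rw [A.inv_mul]; noncomm_ring
    _ = 1 - X - Y + X * Y := by rw [hXY, mul_add]; abel
    _ = (1 + -((1 - P) * (1 - A)) * P) * (1 - Y) := by rw [neg_mul, ← hX]; noncomm_ring

theorem det_compression_inv_mul {A : (E →L[ℂ] E)ˣ} {d dQ : ℂ}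
    (hd : HasFredholmDet (A : E →L[ℂ] E) d)
    (hdQ : HasFredholmDet
      (1 - (1 - W.starProjection) * (1 - (A : E →L[ℂ] E)) * (1 - W.starProjection)) dQ) :
    LinearMap.det (compression W (↑A⁻¹ : E →L[ℂ] E)).toLinearMap * d = dQ := by
  set P := W.starProjection
  have hcorner : HasFredholmDet (1 + P * ((↑A⁻¹ : E →L[ℂ] E) - 1))
      (LinearMap.det (compression W (↑A⁻¹ : E →L[ℂ] E)).toLinearMap) := by
    simpa using hasFredholmDet_one_add_starProjection_mul W ((↑A⁻¹ : E →L[ℂ] E) - 1)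
  have hlower : HasFredholmDet (1 + -((1 - P) * (1 - (A : E →L[ℂ] E))) * P) 1 := by
    have hcompr : compression W (1 + -((1 - P) * (1 - (A : E →L[ℂ] E)))) = 1 := by
      ext z
      have hP : ∀ x, P (P x) = P x := DFunLike.congr_fun W.isIdempotentElem_starProjection
      simp [compression, ← W.starProjection_apply, P, hP]
    simpa [hcompr] using
      hasFredholmDet_one_add_mul_starProjection W (-((1 - P) * (1 - (A : E →L[ℂ] E))))
  have hcomm : (1 + P * ((↑A⁻¹ : E →L[ℂ] E) - 1)) * A =
      (1 + -((1 - P) * (1 - (A : E →L[ℂ] E))) * P) *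
        (1 - (1 - P) * (1 - (A : E →L[ℂ] E)) * (1 - P)) :=
    jacobi_factorization A W.isIdempotentElem_starProjection
  have hprod := hcorner.mul hd
  rw [hcomm] at hprod
  simpa using hprod.unique (hlower.mul hdQ)

end Jacobi

section

/-! ### Multiplication operators -/

/-- Normalised Haar measure on `ℝ/ℤ`. -/
abbrev haar : Measure UnitAddCircle := AddCircle.haarAddCircle (T := (1 : ℝ))

lemma continuous_pt : Continuous pt := AddCircle.continuous_toCircle

lemma memLp_of_continuous {F : Type*} [NormedAddCommGroup F] {p : ℝ≥0∞} {g : UnitAddCircle → F}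
    (hg : Continuous g) : MemLp g p haar :=
  hg.memLp_of_hasCompactSupport (.of_compactSpace g)

variable {m : ℕ}

lemma memLInf_of_continuous {a : Circle → Mat m} (ha : Continuous a) : MemLInf a := by
  refine memLp_of_continuous ?_
  have h : Continuous fun A : Mat m => Matrix.toEuclideanCLM (n := Fin m) (𝕜 := ℂ) A :=
    LinearMap.continuous_of_finiteDimensional
      (Matrix.toEuclideanCLM (n := Fin m) (𝕜 := ℂ)).toAlgEquiv.toLinearMap
  exact h.comp (ha.comp continuous_pt)

lemma mulOp_ae {a : Circle → Mat m} (ha : Continuous a) (f : L2 m) :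
    mulOp a f =ᵐ[haar] fun x => opSymbol a x (f x) := by
  rw [mulOp, dif_pos (memLInf_of_continuous ha), ContinuousLinearMap.holderL_apply_apply]
  refine (ContinuousLinearMap.coeFn_holder _ _ _).trans ?_
  filter_upwards [MemLp.coeFn_toLp (memLInf_of_continuous ha)] with x hx
  rw [hx]; rfl

lemma mulOp_mul {a b : Circle → Mat m} (ha : Continuous a) (hb : Continuous b) :
    mulOp (fun t => a t * b t) = mulOp a ∘L mulOp b := by
  ext1 f
  refine Lp.ext ?_
  filter_upwards [mulOp_ae (a := fun t => a t * b t) (ha.mul hb) f, mulOp_ae ha (mulOp b f),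
    mulOp_ae hb f] with x h1 h2 h3
  rw [h1, ContinuousLinearMap.comp_apply, h2, h3]
  simp only [opSymbol, map_mul]
  rfl

lemma mulOp_one : mulOp (fun _ => (1 : Mat m)) = 1 := by
  ext1 f
  refine Lp.ext ?_
  filter_upwards [mulOp_ae (continuous_const (y := (1 : Mat m))) f] with x h1
  rw [h1]
  simp only [opSymbol, map_one]
  rfl

lemma adjoint_mulOp {a : Circle → Mat m} (ha : Continuous a) :
    ContinuousLinearMap.adjoint (mulOp a) = mulOp (fun t => (a t).conjTranspose) := by
  symm
  rw [ContinuousLinearMap.eq_adjoint_iff]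
  intro f g
  rw [L2.inner_def, L2.inner_def]
  refine integral_congr_ae ?_
  filter_upwards [mulOp_ae ha.matrix_conjTranspose f, mulOp_ae ha g] with x h1 h2
  rw [h1, h2]
  have : opSymbol (fun t => (a t).conjTranspose) x =
      ContinuousLinearMap.adjoint (opSymbol a x) := by
    rw [← ContinuousLinearMap.star_eq_adjoint, opSymbol, opSymbol, ← map_star]
    rfl
  rw [this, ContinuousLinearMap.adjoint_inner_left]

lemma inner_mulOp_left {a : Circle → Mat m} (ha : Continuous a) (f g : L2 m) :
    inner ℂ (mulOp a f) g = inner ℂ f (mulOp (fun t => (a t).conjTranspose) g) := by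
  rw [← adjoint_mulOp ha, ContinuousLinearMap.adjoint_inner_right]

/-! ### Continuous functions as elements of `L²` -/

/-- The element `h · e_i` of `L²(𝕋; ℂᵐ)`, for a continuous function `h`; linear in `h`. -/
def contVec (i : Fin m) : C(Circle, ℂ) →ₗ[ℂ] L2 m where
  toFun h := MemLp.toLp (fun x => h (pt x) • (EuclideanSpace.single i (1 : ℂ) : Vec m))
    (memLp_of_continuous ((h.continuous.comp continuous_pt).smul continuous_const))
  map_add' h g := by
    rw [← MemLp.toLp_add]
    exact MemLp.toLp_congr _ _ (.of_forall fun x => add_smul (h (pt x)) (g (pt x)) _)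
  map_smul' c h := by
    rw [RingHom.id_apply, ← MemLp.toLp_const_smul]
    exact MemLp.toLp_congr _ _ (.of_forall fun x => smul_assoc c (h (pt x)) _)

lemma contVec_ae (h : C(Circle, ℂ)) (i : Fin m) :
    contVec i h =ᵐ[haar] fun x => h (pt x) • (EuclideanSpace.single i (1 : ℂ) : Vec m) :=
  MemLp.coeFn_toLp
    (memLp_of_continuous ((h.continuous.comp continuous_pt).smul continuous_const))

lemma inner_contVec (h : C(Circle, ℂ)) (i : Fin m) (f : L2 m) :
    inner ℂ (contVec i h) f = ∫ x, conj (h (pt x)) * (f x) i ∂haar := by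
  rw [L2.inner_def]
  refine integral_congr_ae ?_
  filter_upwards [contVec_ae h i] with x hx
  rw [hx, inner_smul_left, EuclideanSpace.inner_single_left, map_one, one_mul]

lemma inner_contVec_mulOp {a : Circle → Mat m} (ha : Continuous a) (h g : C(Circle, ℂ))
    (i j : Fin m) :
    inner ℂ (contVec i h) (mulOp a (contVec j g)) =
      ∫ x, conj (h (pt x)) * (a (pt x) i j * g (pt x)) ∂haar := by
  rw [inner_contVec]
  refine integral_congr_ae ?_
  filter_upwards [contVec_ae g j, mulOp_ae ha (contVec j g)] with x hx h1
  rw [h1, hx, map_smul]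
  congr 1
  rw [PiLp.smul_apply, opSymbol, Matrix.ofLp_toEuclideanCLM, smul_eq_mul, mul_comm]
  simp

lemma continuous_scalarSymbol (u : C(Circle, ℂ)) : Continuous (scalarSymbol m u) :=
  u.continuous.smul continuous_const

lemma opSymbol_scalarSymbol (u : Circle → ℂ) (x : UnitAddCircle) :
    opSymbol (scalarSymbol m u) x = u (pt x) • 1 := by
  rw [opSymbol, scalarSymbol, map_smul, map_one]

lemma mulOp_scalar_contVec (u h : C(Circle, ℂ)) (i : Fin m) :
    mulOp (scalarSymbol m u) (contVec i h) = contVec i (u * h) := by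
  refine Lp.ext ?_
  filter_upwards [contVec_ae h i, contVec_ae (u * h) i,
    mulOp_ae (continuous_scalarSymbol u) (contVec i h)] with x h1 h2 h3
  rw [h3, h2, h1, opSymbol_scalarSymbol, ContinuousMap.mul_apply, mul_smul]
  rfl

/-! ### The Fourier basis -/

/-- The function `t ↦ t^n` on the circle. -/
def zpowFn (n : ℤ) : C(Circle, ℂ) :=
  ⟨fun t => ((t ^ n : Circle) : ℂ), continuous_induced_dom.comp (continuous_zpow n)⟩

lemma zpowFn_apply (n : ℤ) (t : Circle) : zpowFn n t = (t : ℂ) ^ n := by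
  simp [zpowFn]

lemma zpowFn_pt (n : ℤ) (x : UnitAddCircle) : zpowFn n (pt x) = fourier n x := by
  rw [fourier_apply, AddCircle.toCircle_zsmul]
  rfl

/-- The element `t^n e_i` of `L²`. -/
def monomial (n : ℤ) (i : Fin m) : L2 m := contVec i (zpowFn n)

lemma integrable_L2 (f : L2 m) : Integrable f haar :=
  (Lp.memLp f).integrable (by norm_num)

lemma inner_monomial_eq_fourierCoeff (n : ℤ) (i : Fin m) (f : L2 m) :
    inner ℂ (monomial n i) f = fourierCoeff (fun x => (f x) i) n := by
  simp only [monomial, inner_contVec, fourierCoeff, zpowFn_pt, fourier_neg, smul_eq_mul]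

lemma inner_monomial (n : ℤ) (i : Fin m) (f : L2 m) :
    inner ℂ (monomial n i) f = (fourierCoeff f n) i := by
  rw [inner_monomial_eq_fourierCoeff]
  exact (EuclideanSpace.proj i : Vec m →L[ℂ] ℂ).integral_comp_comm
    ((integrable_L2 f).fourier_smul (-n))

lemma mem_H2_iff (f : L2 m) : f ∈ H2 m ↔ ∀ n : ℤ, n < 0 → ∀ i, inner ℂ (monomial n i) f = 0 := by
  simp only [inner_monomial]
  constructor
  · intro h n hn i
    have : fourierCoeff f n = 0 := h n hn
    rw [this]; rfl
  · intro h n hn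
    ext i
    exact h n hn i

lemma inner_monomial_mulOp_monomial {a : Circle → Mat m} (ha : Continuous a) (n k : ℤ)
    (i j : Fin m) :
    inner ℂ (monomial n i) (mulOp a (monomial k j)) = coeff a (n - k) i j := by
  rw [monomial, monomial, inner_contVec_mulOp ha, coeff, Matrix.of_apply, fourierCoeff]
  refine integral_congr_ae (Eventually.of_forall fun x => ?_)
  simp only [zpowFn_pt, smul_eq_mul]
  rw [← fourier_neg, neg_sub, sub_eq_add_neg, fourier_add]
  ring

lemma coeff_one (n : ℤ) : coeff (fun _ => (1 : Mat m)) n = if n = 0 then 1 else 0 := by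
  ext i j
  have h := fourierCoeff_fourier (T := (1 : ℝ)) 0
  have hc : (fun _ : UnitAddCircle => (1 : Mat m) i j) =
      fun x => (1 : Mat m) i j * fourier 0 x := by
    funext x; simp
  rw [coeff, Matrix.of_apply, hc, fourierCoeff.const_mul, h]
  by_cases hn : n = 0 <;> simp [hn]

lemma orthonormal_monomial : Orthonormal ℂ (fun p : ℤ × Fin m => monomial (m := m) p.1 p.2) := by
  classical
  rw [orthonormal_iff_ite]
  rintro ⟨n, i⟩ ⟨k, j⟩
  have h := inner_monomial_mulOp_monomial (continuous_const (y := (1 : Mat m))) n k i j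
  rw [mulOp_one, one_apply_eq_self, coeff_one] at h
  rw [h]
  by_cases hn : n = k
  · simp [hn, Matrix.one_apply]
  · rw [if_neg (by omega), if_neg (by simp [hn])]; rfl

lemma ae_eq_zero_of_fourierCoeff_eq_zero {g : UnitAddCircle → ℂ} (hg : MemLp g 2 haar)
    (h : ∀ n, fourierCoeff g n = 0) : g =ᵐ[haar] 0 := by
  have h0 : hg.toLp g = 0 := by
    rw [← (fourierBasis (T := (1 : ℝ))).repr.map_eq_zero_iff]
    ext n
    rw [fourierBasis_repr, fourierCoeff_congr_ae hg.coeFn_toLp, h]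
    rfl
  exact (MemLp.toLp_eq_toLp_iff hg MemLp.zero').mp h0

lemma eq_zero_of_fourierCoeff_eq_zero (f : L2 m) (hf : ∀ n, fourierCoeff f n = 0) : f = 0 := by
  have hi : ∀ i, (fun x => (f x) i) =ᵐ[haar] 0 := fun i =>
    ae_eq_zero_of_fourierCoeff_eq_zero
      ((EuclideanSpace.proj i : Vec m →L[ℂ] ℂ).comp_memLp' (Lp.memLp f)) fun n => by
        rw [← inner_monomial_eq_fourierCoeff, inner_monomial, hf]; rfl
  refine Lp.eq_zero_iff_ae_eq_zero.mpr ?_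
  filter_upwards [ae_all_iff.mpr hi] with x hx
  ext i
  exact hx i

lemma span_monomial_orthogonal :
    (Submodule.span ℂ (Set.range fun p : ℤ × Fin m => monomial (m := m) p.1 p.2))ᗮ = ⊥ := by
  rw [Submodule.eq_bot_iff]
  intro f hf
  refine eq_zero_of_fourierCoeff_eq_zero f fun n => ?_
  ext i
  rw [← inner_monomial]
  exact (Submodule.mem_orthogonal _ _).mp hf _ (Submodule.subset_span ⟨(n, i), rfl⟩)

/-- The Hilbert basis `t^n e_i` of `L²`. -/
def monomialBasis (m : ℕ) : HilbertBasis (ℤ × Fin m) ℂ (L2 m) :=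
  HilbertBasis.mkOfOrthogonalEqBot orthonormal_monomial span_monomial_orthogonal

lemma monomialBasis_apply (p : ℤ × Fin m) : monomialBasis m p = monomial p.1 p.2 := by
  rw [monomialBasis, HilbertBasis.coe_mkOfOrthogonalEqBot]

lemma ext_monomial {f g : L2 m}
    (h : ∀ n i, inner ℂ (monomial n i) f = inner ℂ (monomial n i) g) : f = g := by
  rw [← sub_eq_zero]
  refine eq_zero_of_fourierCoeff_eq_zero _ fun n => ?_
  ext i
  rw [← inner_monomial, inner_sub_right, h, sub_self]; rfl

lemma monomial_mem_H2 {n : ℤ} (hn : 0 ≤ n) (i : Fin m) : monomial n i ∈ H2 m := by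
  classical
  rw [mem_H2_iff]
  intro k hk j
  have := orthonormal_iff_ite.mp (orthonormal_monomial (m := m)) (k, j) (n, i)
  rw [if_neg (by simp; omega)] at this
  exact this

lemma mem_H2_orthogonal_iff (f : L2 m) :
    f ∈ (H2 m)ᗮ ↔ ∀ n : ℤ, 0 ≤ n → ∀ i, inner ℂ (monomial n i) f = 0 := by
  constructor
  · intro h n hn i
    exact (Submodule.mem_orthogonal _ _).mp h _ (monomial_mem_H2 hn i)
  · intro h
    rw [Submodule.mem_orthogonal]
    intro g hg
    rw [← (monomialBasis m).tsum_inner_mul_inner]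
    refine (tsum_congr fun p => ?_).trans tsum_zero
    rw [monomialBasis_apply]
    rcases lt_or_ge p.1 0 with hp | hp
    · rw [← inner_conj_symm, (mem_H2_iff g).mp hg _ hp, map_zero, zero_mul]
    · rw [h _ hp, mul_zero]

lemma inner_monomial_starProjection (n : ℤ) (i : Fin m) (f : L2 m) :
    inner ℂ (monomial n i) ((H2 m).starProjection f) =
      if 0 ≤ n then inner ℂ (monomial n i) f else 0 := by
  split_ifs with hn
  · rw [← Submodule.inner_starProjection_left_eq_right,
      Submodule.starProjection_eq_self_iff.mpr (monomial_mem_H2 hn i)]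
  · exact (mem_H2_iff _).mp (Submodule.starProjection_apply_mem _ _) n (not_le.mp hn) i

end

section

variable {m : ℕ}

/-! ### Analytic and coanalytic symbols -/

/-- Continuous analytic matrix functions, i.e. without Fourier coefficients of negative index;
multiplication by them maps `H²` into itself. -/
structure IsPlus (a : Circle → Mat m) : Prop where
  continuous : Continuous a
  coeff_neg : ∀ n : ℤ, n < 0 → coeff a n = 0

/-- Continuous coanalytic matrix functions, i.e. the adjoints of analytic ones; multiplication by
them maps the orthogonal complement of `H²` into itself. -/
def IsMinus (a : Circle → Mat m) : Prop := IsPlus fun t => (a t).conjTranspose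

lemma IsPlus.conjTranspose {a : Circle → Mat m} (ha : IsPlus a) :
    IsMinus fun t => (a t).conjTranspose := by
  simpa only [IsMinus, Matrix.conjTranspose_conjTranspose] using ha

lemma IsMinus.continuous {a : Circle → Mat m} (ha : IsMinus a) : Continuous a := by
  simpa only [Matrix.conjTranspose_conjTranspose] using
    (IsPlus.continuous ha).matrix_conjTranspose

lemma IsPlus.mulOp_mem {a : Circle → Mat m} (ha : IsPlus a) {f : L2 m} (hf : f ∈ H2 m) :
    mulOp a f ∈ H2 m := by
  rw [mem_H2_iff]
  intro n hn i
  rw [← ContinuousLinearMap.adjoint_inner_left]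
  have h : ContinuousLinearMap.adjoint (mulOp a) (monomial n i) ∈ (H2 m)ᗮ := by
    rw [mem_H2_orthogonal_iff]
    intro k hk j
    rw [ContinuousLinearMap.adjoint_inner_right, ← inner_conj_symm,
      inner_monomial_mulOp_monomial ha.continuous, ha.coeff_neg _ (by omega)]
    simp
  exact (Submodule.mem_orthogonal' _ _).mp h f hf

lemma IsMinus.mulOp_mem {a : Circle → Mat m} (ha : IsMinus a) {f : L2 m} (hf : f ∈ (H2 m)ᗮ) :
    mulOp a f ∈ (H2 m)ᗮ := by
  rw [Submodule.mem_orthogonal']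
  intro g hg
  rw [inner_mulOp_left ha.continuous]
  exact (Submodule.mem_orthogonal' _ _).mp hf _ (IsPlus.mulOp_mem ha hg)

/-! ### The flip operator -/

lemma pt_neg (x : UnitAddCircle) : pt (-x) = (pt x)⁻¹ := AddCircle.toCircle_neg x

lemma ae_comp_neg {p : UnitAddCircle → Prop} (h : ∀ᵐ x ∂haar, p x) : ∀ᵐ x ∂haar, p (-x) :=
  measurePreserving_neg_circle.quasiMeasurePreserving.ae h

lemma flip_ae (f : L2 m) :
    flip m f =ᵐ[haar] fun x => (((pt x)⁻¹ : Circle) : ℂ) • f (-x) := by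
  have hc : Continuous (scalarSymbol m fun t => ((t⁻¹ : Circle) : ℂ)) :=
    continuous_scalarSymbol ⟨fun t => ((t⁻¹ : Circle) : ℂ), by fun_prop⟩
  have h1 := mulOp_ae hc (Lp.compMeasurePreserving (fun x : UnitAddCircle => -x)
    measurePreserving_neg_circle f)
  have h2 := Lp.coeFn_compMeasurePreserving f measurePreserving_neg_circle
  filter_upwards [h1, h2] with x h1 h2
  refine h1.trans ?_
  rw [h2, opSymbol_scalarSymbol]
  rfl

lemma conj_zpowFn (k : ℤ) (t : Circle) : conj (zpowFn k t) = (t : ℂ) ^ (-k) := by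
  rw [zpowFn_apply, map_zpow₀, ← Circle.coe_inv_eq_conj, Circle.coe_inv, inv_zpow, zpow_neg]

lemma inner_monomial_flip (n : ℤ) (i : Fin m) (f : L2 m) :
    inner ℂ (monomial n i) (flip m f) = inner ℂ (monomial (-n - 1) i) f := by
  rw [monomial, monomial, inner_contVec, inner_contVec,
    ← (measurePreserving_neg_circle).integral_comp (MeasurableEquiv.neg _).measurableEmbedding
      (fun x => conj (zpowFn (-n - 1) (pt x)) * (f x) i)]
  refine integral_congr_ae ?_
  filter_upwards [flip_ae f] with x hx
  rw [hx, PiLp.smul_apply, smul_eq_mul, ← mul_assoc]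
  congr 1
  rw [pt_neg]
  have h0 : (pt x : ℂ) ≠ 0 := Circle.coe_ne_zero _
  rw [conj_zpowFn, conj_zpowFn, Circle.coe_inv, inv_zpow, ← zpow_neg, ← zpow_neg_one,
    ← zpow_add₀ h0]
  congr 1
  ring

lemma flip_mem_orthogonal {f : L2 m} (hf : f ∈ H2 m) : flip m f ∈ (H2 m)ᗮ := by
  rw [mem_H2_orthogonal_iff]
  intro n hn i
  rw [inner_monomial_flip]
  exact (mem_H2_iff f).mp hf _ (by omega) i

lemma flip_mulOp {a : Circle → Mat m} (ha : Continuous a) (f : L2 m) :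
    mulOp (tilde a) (flip m f) = flip m (mulOp a f) := by
  have hta : Continuous (tilde a) := ha.comp continuous_inv
  refine Lp.ext ?_
  filter_upwards [mulOp_ae hta (flip m f), flip_ae f, flip_ae (mulOp a f),
    ae_comp_neg (mulOp_ae ha f)] with x h1 h2 h3 h4
  rw [h1, h2, h3, h4, map_smul]
  simp only [opSymbol, tilde, pt_neg]

lemma flip_starProjection_flip (f : L2 m) :
    flip m ((H2 m).starProjection (flip m f)) = f - (H2 m).starProjection f := by
  refine ext_monomial fun n i => ?_
  rw [inner_monomial_flip, inner_monomial_starProjection, inner_monomial_flip, inner_sub_right,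
    inner_monomial_starProjection, show -(-n - 1) - 1 = n by ring]
  split_ifs with h1 h2 h2 <;> first | omega | simp

/-! ### Toeplitz and Hankel operators -/

lemma coe_proj (f : L2 m) : (proj m f : L2 m) = (H2 m).starProjection f := rfl

lemma proj_eq_zero {f : L2 m} (hf : f ∈ (H2 m)ᗮ) : proj m f = 0 := by
  apply Subtype.ext
  rw [coe_proj, (Submodule.starProjection_apply_eq_zero_iff _).mpr hf]; rfl

lemma coe_proj_of_mem {f : L2 m} (hf : f ∈ H2 m) : (proj m f : L2 m) = f :=
  Submodule.starProjection_eq_self_iff.mpr hf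

lemma inner_proj_right (g : H2 m) (f : L2 m) :
    inner ℂ g (proj m f) = inner ℂ (g : L2 m) f :=
  Submodule.inner_orthogonalProjectionOnto_eq_of_mem_left g f

lemma toeplitz_apply (a : Circle → Mat m) (f : H2 m) :
    toeplitz a f = proj m (mulOp a (f : L2 m)) := rfl

lemma toeplitz_one : toeplitz (fun _ => (1 : Mat m)) = 1 := by
  ext1 f
  apply Subtype.ext
  rw [toeplitz_apply, mulOp_one, one_apply_eq_self, coe_proj_of_mem f.2]; rfl

lemma toeplitz_mul_of_isPlus {a b : Circle → Mat m} (ha : Continuous a) (hb : IsPlus b) :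
    toeplitz (fun t => a t * b t) = toeplitz a * toeplitz b := by
  ext1 f
  rw [mul_apply_eq_comp, toeplitz_apply, toeplitz_apply, toeplitz_apply,
    coe_proj_of_mem (hb.mulOp_mem f.2), mulOp_mul ha hb.continuous]
  rfl

lemma proj_mulOp_starProjection {a : Circle → Mat m} (ha : IsMinus a) (f : L2 m) :
    proj m (mulOp a ((H2 m).starProjection f)) = proj m (mulOp a f) := by
  rw [← sub_eq_zero, ← map_sub, ← map_sub, ← neg_sub, map_neg, map_neg, neg_eq_zero]
  exact proj_eq_zero (ha.mulOp_mem (Submodule.sub_starProjection_mem_orthogonal f))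

lemma toeplitz_mul_of_isMinus {a b : Circle → Mat m} (ha : IsMinus a) (hb : Continuous b) :
    toeplitz (fun t => a t * b t) = toeplitz a * toeplitz b := by
  ext1 f
  rw [mul_apply_eq_comp, toeplitz_apply, toeplitz_apply, toeplitz_apply, coe_proj,
    proj_mulOp_starProjection ha, mulOp_mul ha.continuous hb]
  rfl

lemma inner_toeplitz_left {a : Circle → Mat m} (ha : Continuous a) (f g : H2 m) :
    inner ℂ (toeplitz a f) g = inner ℂ f (toeplitz (fun t => (a t).conjTranspose) g) := by
  rw [toeplitz_apply, toeplitz_apply, inner_proj_right, ← inner_mulOp_left ha,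
    ← inner_conj_symm (proj m _) g, inner_proj_right, inner_conj_symm]

/-- The operator `f ↦ P (a (I - P) (c f))` on `H²`, i.e. `H(a) H(c̃)` without the flips. -/
def hankelProd (a c : Circle → Mat m) : H2 m →L[ℂ] H2 m :=
  proj m ∘L mulOp a ∘L (1 - (H2 m).starProjection) ∘L mulOp c ∘L (H2 m).subtypeL

lemma hankelProd_apply (a c : Circle → Mat m) (f : H2 m) :
    hankelProd a c f = proj m (mulOp a (mulOp c (f : L2 m) -
      (H2 m).starProjection (mulOp c (f : L2 m)))) := rfl

lemma hankel_apply (a : Circle → Mat m) (f : H2 m) :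
    hankel a f = proj m (mulOp a (flip m (f : L2 m))) := by
  have h : hankel a f = proj m (mulOp a (flip m (f : L2 m) -
    (H2 m).starProjection (flip m (f : L2 m)))) := rfl
  rw [h, (Submodule.starProjection_apply_eq_zero_iff _).mpr (flip_mem_orthogonal f.2), sub_zero]

lemma hankel_mul_hankel_tilde {b c : Circle → Mat m} (hc : Continuous c) :
    hankel b * hankel (tilde c) = hankelProd b c := by
  ext1 f
  rw [mul_apply_eq_comp, hankelProd_apply, hankel_apply, hankel_apply,
    flip_mulOp hc, coe_proj, flip_starProjection_flip]

lemma toeplitz_mul {b c : Circle → Mat m} (hb : Continuous b) (hc : Continuous c) :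
    toeplitz (fun t => b t * c t) = toeplitz b * toeplitz c + hankelProd b c := by
  ext1 f
  rw [add_apply, hankelProd_apply, mul_apply_eq_comp, toeplitz_apply, toeplitz_apply,
    toeplitz_apply, coe_proj, ← map_add, ← map_add, add_sub_cancel, mulOp_mul hb hc]
  rfl

lemma hankelProd_factor {v a c w : Circle → Mat m} (hv : IsMinus v) (ha : Continuous a)
    (hc : Continuous c) (hw : IsPlus w) :
    hankelProd (fun t => v t * a t) (fun t => c t * w t) =
      toeplitz v * hankelProd a c * toeplitz w := by
  ext1 f
  simp only [mul_apply_eq_comp, hankelProd_apply, toeplitz_apply, coe_proj]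
  rw [Submodule.starProjection_eq_self_iff.mpr (hw.mulOp_mem f.2), proj_mulOp_starProjection hv,
    mulOp_mul hv.continuous ha, mulOp_mul hc hw.continuous]
  rfl

/-! ### Wiener–Hopf factorization -/

lemma IsPlus.transpose {a : Circle → Mat m} (ha : IsPlus a) : IsPlus fun t => (a t).transpose where
  continuous := ha.continuous.matrix_transpose
  coeff_neg n hn :=
    (congrArg Matrix.transpose (ha.coeff_neg n hn)).trans Matrix.transpose_zero

lemma IsPlusFactor.isPlus {w : Circle → Mat m} (hw : IsPlusFactor w) : IsPlus w :=
  ⟨hw.memWK.1, hw.memHInf.2⟩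

lemma IsPlusFactor.inv_isPlus {w : Circle → Mat m} (hw : IsPlusFactor w) :
    IsPlus fun t => (w t)⁻¹ :=
  ⟨hw.inv_memWK.1, hw.inv_memHInf.2⟩

lemma conjTranspose_inv_eq (w : Circle → Mat m) (t : Circle) :
    ((w t)⁻¹).conjTranspose = (invSymbol (conjSymbol w) t).transpose := by
  rw [Matrix.conjTranspose_nonsing_inv, invSymbol, Matrix.transpose_nonsing_inv]
  rfl

lemma IsMinusFactor.isUnit {w : Circle → Mat m} (hw : IsMinusFactor w) (t : Circle) :
    IsUnit (w t) := by
  rw [← Matrix.isUnit_conjTranspose]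
  exact (Matrix.isUnit_transpose _).mpr (IsPlusFactor.isUnit hw t)

lemma IsMinusFactor.isMinus {w : Circle → Mat m} (hw : IsMinusFactor w) : IsMinus w :=
  (IsPlusFactor.isPlus hw).transpose

lemma IsMinusFactor.inv_isMinus {w : Circle → Mat m} (hw : IsMinusFactor w) :
    IsMinus fun t => (w t)⁻¹ := by
  simp only [IsMinus, conjTranspose_inv_eq]
  exact (IsPlusFactor.inv_isPlus hw).transpose

lemma mul_inv_symbol {w : Circle → Mat m} (hw : ∀ t, IsUnit (w t)) :
    (fun t => w t * (w t)⁻¹) = fun _ => 1 :=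
  funext fun t => Matrix.mul_nonsing_inv _ ((Matrix.isUnit_iff_isUnit_det _).mp (hw t))

lemma inv_mul_symbol {w : Circle → Mat m} (hw : ∀ t, IsUnit (w t)) :
    (fun t => (w t)⁻¹ * w t) = fun _ => 1 :=
  funext fun t => Matrix.nonsing_inv_mul _ ((Matrix.isUnit_iff_isUnit_det _).mp (hw t))

/-- The Toeplitz operator with a plus factor as symbol, as an invertible operator with inverse
`T(w⁻¹)`. -/
def IsPlusFactor.toeplitzUnit {w : Circle → Mat m} (hw : IsPlusFactor w) :
    (H2 m →L[ℂ] H2 m)ˣ where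
  val := toeplitz w
  inv := toeplitz fun t => (w t)⁻¹
  val_inv := by
    rw [← toeplitz_mul_of_isPlus hw.isPlus.continuous hw.inv_isPlus, mul_inv_symbol hw.isUnit,
      toeplitz_one]
  inv_val := by
    rw [← toeplitz_mul_of_isPlus hw.inv_isPlus.continuous hw.isPlus, inv_mul_symbol hw.isUnit,
      toeplitz_one]

/-- The Toeplitz operator with a minus factor as symbol, as an invertible operator with inverse
`T(w⁻¹)`. -/
def IsMinusFactor.toeplitzUnit {w : Circle → Mat m} (hw : IsMinusFactor w) :
    (H2 m →L[ℂ] H2 m)ˣ where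
  val := toeplitz w
  inv := toeplitz fun t => (w t)⁻¹
  val_inv := by
    rw [← toeplitz_mul_of_isMinus hw.isMinus hw.inv_isMinus.continuous, mul_inv_symbol hw.isUnit,
      toeplitz_one]
  inv_val := by
    rw [← toeplitz_mul_of_isMinus hw.inv_isMinus hw.isMinus.continuous, inv_mul_symbol hw.isUnit,
      toeplitz_one]

lemma one_sub_hankel_mul_hankel {b c : Circle → Mat m} (hb : Continuous b) (hc : Continuous c)
    (hbc : ∀ t, b t * c t = 1) :
    1 - hankel b * hankel (tilde c) = toeplitz b * toeplitz c := by
  have h := toeplitz_mul hb hc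
  rw [funext hbc, toeplitz_one] at h
  rw [h, hankel_mul_hankel_tilde hc, add_sub_cancel_right]

section

variable {wm wp vp vm : Circle → Mat m} (hwm : IsMinusFactor wm) (hwp : IsPlusFactor wp)
  (hvp : IsPlusFactor vp) (hvm : IsMinusFactor vm) (h : ∀ t, wm t * wp t = vp t * vm t)

include hvp hvm h in
lemma mul_inv_mul_inv_mul_eq_one (t : Circle) :
    vm t * (wp t)⁻¹ * ((wm t)⁻¹ * vp t) = 1 := by
  have hinv : (wp t)⁻¹ * (wm t)⁻¹ = (vm t)⁻¹ * (vp t)⁻¹ := by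
    rw [← Matrix.mul_inv_rev, h, Matrix.mul_inv_rev]
  calc vm t * (wp t)⁻¹ * ((wm t)⁻¹ * vp t)
      = vm t * ((wp t)⁻¹ * (wm t)⁻¹) * vp t := by simp only [mul_assoc]
    _ = (vm t * (vm t)⁻¹) * ((vp t)⁻¹ * vp t) := by rw [hinv]; simp only [mul_assoc]
    _ = 1 := by
      rw [congrFun (mul_inv_symbol hvm.isUnit) t, congrFun (inv_mul_symbol hvp.isUnit) t, one_mul]

include hwm hwp hvp hvm h in
theorem exists_unit_one_sub_hankel_mul_hankel :
    ∃ U : (H2 m →L[ℂ] H2 m)ˣ,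
      (U : H2 m →L[ℂ] H2 m) = 1 - hankel (fun t => vm t * (wp t)⁻¹) *
        hankel (tilde fun t => (wm t)⁻¹ * vp t) ∧
      toeplitz (fun t => wm t * wp t) =
        toeplitz vp * ((U⁻¹ : (H2 m →L[ℂ] H2 m)ˣ) : H2 m →L[ℂ] H2 m) * toeplitz vm := by
  refine ⟨hvm.toeplitzUnit * hwp.toeplitzUnit⁻¹ * (hwm.toeplitzUnit⁻¹ * hvp.toeplitzUnit), ?_, ?_⟩
  · have hbc := one_sub_hankel_mul_hankel
      (hvm.isMinus.continuous.mul hwp.inv_isPlus.continuous)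
      (hwm.inv_isMinus.continuous.mul hvp.isPlus.continuous)
      (mul_inv_mul_inv_mul_eq_one hvp hvm h)
    refine Eq.trans ?_ hbc.symm
    rw [Pi.mul_def, Pi.mul_def, toeplitz_mul_of_isMinus hvm.isMinus hwp.inv_isPlus.continuous,
      toeplitz_mul_of_isPlus hwm.inv_isMinus.continuous hvp.isPlus]
    rfl
  · have hT : hwm.toeplitzUnit * hwp.toeplitzUnit = hvp.toeplitzUnit *
        (hvm.toeplitzUnit * hwp.toeplitzUnit⁻¹ * (hwm.toeplitzUnit⁻¹ * hvp.toeplitzUnit))⁻¹ *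
        hvm.toeplitzUnit := by group
    rw [toeplitz_mul_of_isPlus hwm.isMinus.continuous hwp.isPlus]
    exact congrArg Units.val hT

end

end

section

/-! ### Trace class property of products of Hankel operators -/

lemma summable_add_of_summable_mul {g : ℕ → ℝ} (hg : ∀ n, 0 ≤ g n)
    (h : Summable fun n : ℕ => ((n : ℝ) + 1) * g n) :
    Summable fun p : ℕ × ℕ => g (p.1 + p.2) := by
  rw [← (Finset.HasAntidiagonal.sigmaAntidiagonalEquivProd (A := ℕ)).summable_iff,
    summable_sigma_of_nonneg fun _ => by rw [Function.comp_apply]; exact hg _]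
  refine ⟨fun n => (hasSum_fintype _).summable, h.congr fun n => ?_⟩
  have hconst (q : Finset.HasAntidiagonal.antidiagonal n) : g (q.1.1 + q.1.2) = g n :=
    congrArg g (Finset.HasAntidiagonal.mem_antidiagonal.mp q.2)
  rw [tsum_fintype]
  exact ((Finset.sum_congr rfl fun q _ => hconst q).trans (by simp)).symm

variable {m : ℕ}

lemma hasSum_sub_starProjection (f : L2 m) :
    HasSum (fun p : ℕ × Fin m => inner ℂ (monomial (Int.negSucc p.1) p.2) f •
      monomial (Int.negSucc p.1) p.2) (f - (H2 m).starProjection f) := by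
  have h := (monomialBasis m).hasSum_repr (f - (H2 m).starProjection f)
  simp only [HilbertBasis.repr_apply_apply, monomialBasis_apply, inner_sub_right,
    inner_monomial_starProjection] at h
  have hinj : Function.Injective (Prod.map Int.negSucc (id : Fin m → Fin m)) :=
    Function.Injective.prodMap (fun _ _ => Int.negSucc.inj) Function.injective_id
  rw [← hinj.hasSum_iff] at h
  · simpa [Function.comp_def] using h
  · rintro ⟨n | n, i⟩ hn
    · simp
    · exact absurd ⟨(n, i), rfl⟩ hn

lemma hasSum_norm_sq_inner {ι E : Type*} [NormedAddCommGroup E] [InnerProductSpace ℂ E]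
    (e : HilbertBasis ι ℂ E) (f : E) : HasSum (fun i => ‖inner ℂ (e i) f‖ ^ 2) (‖f‖ ^ 2) := by
  simpa [HilbertBasis.repr_apply_apply] using lp.hasSum_norm (by norm_num) (e.repr f)

lemma hasSum_norm_sq_proj (f : L2 m) :
    HasSum (fun p : ℕ × Fin m => ‖inner ℂ (monomial (p.1 : ℤ) p.2) f‖ ^ 2) (‖proj m f‖ ^ 2) := by
  have h := hasSum_norm_sq_inner (monomialBasis m) ((H2 m).starProjection f)
  simp only [monomialBasis_apply, inner_monomial_starProjection] at h
  have hinj : Function.Injective (Prod.map Nat.cast id : ℕ × Fin m → ℤ × Fin m) :=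
    Function.Injective.prodMap Nat.cast_injective Function.injective_id
  rw [← hinj.hasSum_iff] at h
  · simpa [Function.comp_def, coe_proj] using h
  · rintro ⟨n | n, i⟩ hn
    · exact absurd ⟨(n, i), rfl⟩ hn
    · simp

/-- The Krein condition on the Fourier coefficients with positive index, entrywise. -/
def KreinPlus (a : Circle → Mat m) : Prop :=
  ∀ i j, Summable fun n : ℕ => ((n : ℝ) + 1) * ‖coeff a ((n : ℤ) + 1) i j‖ ^ 2

lemma KreinPlus.transpose {a : Circle → Mat m} (ha : KreinPlus a) :
    KreinPlus fun t => (a t).transpose :=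
  fun i j => ha j i

open scoped Matrix.Norms.Elementwise in
lemma MemWK.kreinPlus {a : Circle → Mat m} (ha : MemWK a) : KreinPlus a := by
  intro i j
  have hinj : Function.Injective fun n : ℕ => (n : ℤ) + 1 := fun k l h => by simpa using h
  refine Summable.of_nonneg_of_le (fun _ => by positivity) (fun n => ?_)
    (ha.2.2.comp_injective hinj)
  have habs : |(((n : ℤ) + 1 : ℤ) : ℝ)| = (n : ℝ) + 1 := by
    push_cast; exact abs_of_nonneg (by positivity)
  rw [Function.comp_apply, habs]
  gcongr
  exact Matrix.norm_entry_le_entrywise_sup_norm (coeff a ((n : ℤ) + 1))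

lemma norm_sq_inner_mulOp_negSucc {a : Circle → Mat m} (hc : Continuous a) (p q : ℕ × Fin m) :
    ‖inner ℂ (monomial (q.1 : ℤ) q.2) (mulOp a (monomial (Int.negSucc p.1) p.2))‖ ^ 2 =
      ‖coeff a (((p.1 + q.1 : ℕ) : ℤ) + 1) q.2 p.2‖ ^ 2 := by
  rw [inner_monomial_mulOp_monomial hc,
    show (q.1 : ℤ) - Int.negSucc p.1 = ((p.1 + q.1 : ℕ) : ℤ) + 1 by omega]

lemma KreinPlus.summable_norm_sq {a : Circle → Mat m} (hc : Continuous a) (ha : KreinPlus a) :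
    Summable fun p : ℕ × Fin m => ‖proj m (mulOp a (monomial (Int.negSucc p.1) p.2))‖ ^ 2 := by
  have hcoeff : Summable fun r : (Fin m × Fin m) × (ℕ × ℕ) =>
      ‖coeff a (((r.2.1 + r.2.2 : ℕ) : ℤ) + 1) r.1.2 r.1.1‖ ^ 2 := by
    rw [summable_prod_of_nonneg fun _ => by positivity]
    exact ⟨fun ij => summable_add_of_summable_mul (fun _ => by positivity) (ha ij.2 ij.1),
      (hasSum_fintype _).summable⟩
  let e : (ℕ × Fin m) × (ℕ × Fin m) ≃ (Fin m × Fin m) × (ℕ × ℕ) :=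
    (Equiv.prodProdProdComm ℕ (Fin m) ℕ (Fin m)).trans (Equiv.prodComm _ _)
  have hsum := e.summable_iff.mpr hcoeff
  rw [summable_prod_of_nonneg fun _ => by rw [Function.comp_apply]; exact sq_nonneg _] at hsum
  refine hsum.2.congr fun p => ?_
  rw [← (hasSum_norm_sq_proj _).tsum_eq]
  exact tsum_congr fun q => (norm_sq_inner_mulOp_negSucc hc p q).symm

lemma isNuclearRep_hankelProd {a c : Circle → Mat m} (ha : Continuous a) (hc : Continuous c)
    (hka : KreinPlus a) (hkc : KreinPlus fun t => (c t).conjTranspose) :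
    IsNuclearRep
      (fun p : ℕ × Fin m =>
        proj m (mulOp (fun t => (c t).conjTranspose) (monomial (Int.negSucc p.1) p.2)))
      (fun p => proj m (mulOp a (monomial (Int.negSucc p.1) p.2))) (hankelProd a c) where
  summable := by
    refine Summable.of_nonneg_of_le (fun p => by positivity) (fun p => ?_)
      ((hkc.summable_norm_sq hc.matrix_conjTranspose).add (hka.summable_norm_sq ha))
    refine le_trans ?_ (two_mul_le_add_sq _ _)
    exact mul_le_mul_of_nonneg_right (le_mul_of_one_le_left (norm_nonneg _) one_le_two)
      (norm_nonneg _)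
  hasSum f := by
    have hterm (p : ℕ × Fin m) :
        inner ℂ (proj m (mulOp (fun t => (c t).conjTranspose)
          (monomial (Int.negSucc p.1) p.2))) f =
        inner ℂ (monomial (Int.negSucc p.1) p.2) (mulOp c (f : L2 m)) := by
      rw [← inner_conj_symm _ f, inner_proj_right, inner_conj_symm,
        inner_mulOp_left hc.matrix_conjTranspose]
      simp only [Matrix.conjTranspose_conjTranspose]
    simp only [hterm]
    have h := (proj m ∘L mulOp a).hasSum (hasSum_sub_starProjection (mulOp c (f : L2 m)))
    simp only [map_smul] at h
    exact h

theorem isTraceClass_hankel_mul_hankel {wm wp vp vm : Circle → Mat m} (hwm : IsMinusFactor wm)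
    (hwp : IsPlusFactor wp) (hvp : IsPlusFactor vp) (hvm : IsMinusFactor vm) :
    IsTraceClass (hankel (fun t => vm t * (wp t)⁻¹) *
      hankel (tilde fun t => (wm t)⁻¹ * vp t)) := by
  have hwmi := hwm.inv_isMinus.continuous
  have hwpi := hwp.inv_isPlus.continuous
  have hkrein : KreinPlus fun t => ((wm t)⁻¹).conjTranspose := by
    simp only [conjTranspose_inv_eq]
    exact (IsPlusFactor.inv_memWK hwm).kreinPlus.transpose
  have hc : Continuous fun t => (wm t)⁻¹ * vp t := hwmi.mul hvp.isPlus.continuous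
  rw [hankel_mul_hankel_tilde hc, hankelProd_factor hvm.isMinus hwpi hwmi hvp.isPlus]
  exact ((isNuclearRep_hankelProd hwpi hwmi hwp.inv_memWK.kreinPlus hkrein).isTraceClass.comp_left
    _).comp_right _

end

section

variable {m : ℕ}

/-! ### The disc algebra -/

/-- Functions of the disc algebra: continuous on the closed unit disc, holomorphic inside. -/
abbrev IsDisc (F : ℂ → ℂ) : Prop := DiffContOnCl ℂ F (Metric.ball 0 1)

lemma closure_unitBall : closure (Metric.ball (0 : ℂ) 1) = Metric.closedBall 0 1 :=
  closure_ball 0 one_ne_zero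

lemma IsDisc.fun_mul {F G : ℂ → ℂ} (hF : IsDisc F) (hG : IsDisc G) :
    IsDisc fun z => F z * G z := hF.smul hG

lemma IsDisc.fun_sum {ι : Type*} (s : Finset ι) {F : ι → ℂ → ℂ} (hF : ∀ i ∈ s, IsDisc (F i)) :
    IsDisc fun z => ∑ i ∈ s, F i z :=
  ⟨DifferentiableOn.fun_sum fun i hi => (hF i hi).1,
    continuousOn_finsetSum s fun i hi => (hF i hi).2⟩

lemma IsDisc.fun_prod {ι : Type*} (s : Finset ι) {F : ι → ℂ → ℂ} (hF : ∀ i ∈ s, IsDisc (F i)) :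
    IsDisc fun z => ∏ i ∈ s, F i z :=
  ⟨DifferentiableOn.fun_finsetProd fun i hi => (hF i hi).1,
    continuousOn_finsetProd s fun i hi => (hF i hi).2⟩

lemma IsDisc.det {V : ℂ → Mat m} (hV : ∀ i j, IsDisc fun z => V z i j) :
    IsDisc fun z => (V z).det := by
  simp only [Matrix.det_apply']
  exact IsDisc.fun_sum _ fun σ _ =>
    IsDisc.fun_mul diffContOnCl_const (IsDisc.fun_prod Finset.univ fun i _ => hV (σ i) i)

lemma coe_circle_mem_closedBall (t : Circle) : (t : ℂ) ∈ Metric.closedBall (0 : ℂ) 1 := by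
  rw [mem_closedBall_zero_iff, Circle.norm_coe]

lemma IsDisc.continuous_circle {F : ℂ → ℂ} (hF : IsDisc F) :
    Continuous fun t : Circle => F t :=
  hF.continuousOn_ball.comp_continuous (by fun_prop) coe_circle_mem_closedBall

lemma IsDisc.eqOn {F G : ℂ → ℂ} (hF : IsDisc F) (hG : IsDisc G)
    (h : ∀ t : Circle, F t = G t) {z : ℂ} (hz : z ∈ Metric.closedBall (0 : ℂ) 1) :
    F z = G z := by
  rw [← closure_unitBall] at hz
  refine Complex.eqOn_closure_of_eqOn_frontier Metric.isBounded_ball hF hG ?_ hz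
  intro w hw
  rw [frontier_ball 0 one_ne_zero, mem_sphere_zero_iff_norm] at hw
  exact h ⟨w, mem_sphere_zero_iff_norm.mpr hw⟩

lemma circle_exp_eq_circleMap (θ : ℝ) : ((Circle.exp θ : Circle) : ℂ) = circleMap 0 1 θ := by
  simp [circleMap, Circle.coe_exp]

lemma integral_circle_exp_eq_circleAverage (F : ℂ → ℂ) :
    1 / (2 * (Real.pi : ℂ)) * ∫ θ in (0 : ℝ)..(2 * Real.pi), F (Circle.exp θ) =
      Real.circleAverage F 0 1 := by
  simp only [circle_exp_eq_circleMap, Real.circleAverage_def, Complex.real_smul, one_div,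
    Complex.ofReal_inv, Complex.ofReal_mul, Complex.ofReal_ofNat]

lemma integral_haar_eq_circleAverage (F : ℂ → ℂ) :
    ∫ x, F (pt x) ∂haar = Real.circleAverage F 0 1 := by
  rw [AddCircle.integral_haarAddCircle, inv_one, one_smul,
    ← UnitAddCircle.intervalIntegral_preimage 0, Real.circleAverage_def]
  have hparam (x : ℝ) : F (pt (x : UnitAddCircle)) = F (circleMap 0 1 (x * (2 * Real.pi))) := by
    rw [← circle_exp_eq_circleMap, pt, AddCircle.toCircle_apply_mk]
    congr 3
    ring
  simp_rw [hparam]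
  rw [intervalIntegral.integral_comp_mul_right (fun θ => F (circleMap 0 1 θ)) (by positivity)]
  simp

lemma one_sub_conj_mul_ne_zero (α : 𝔻) {z : ℂ} (hz : z ∈ Metric.closedBall (0 : ℂ) 1) :
    1 - conj (α : ℂ) * z ≠ 0 := by
  have hlt : ‖conj (α : ℂ) * z‖ < 1 := by
    rw [norm_mul, RCLike.norm_conj]
    exact mul_lt_one_of_nonneg_of_lt_one_left (norm_nonneg _) α.norm_lt_one (by simpa using hz)
  exact fun h => hlt.ne (by rw [← sub_eq_zero.mp h, norm_one])

/-- The Szegő kernel `k_α(z) = 1 / (1 - ᾱ z)`, which reproduces the value at `α` of functions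
in `H²`. -/
def szego (α z : ℂ) : ℂ := (1 - conj α * z)⁻¹

lemma isDisc_szego (α : 𝔻) : IsDisc (szego (α : ℂ)) :=
  DifferentiableOn.diffContOnCl <| by
    rw [closure_unitBall]
    exact DifferentiableOn.fun_inv (by fun_prop) fun z hz => one_sub_conj_mul_ne_zero α hz

lemma isDisc_moebius (α : 𝔻) : IsDisc (moebius (α : ℂ)) :=
  DifferentiableOn.diffContOnCl <| by
    rw [closure_unitBall]
    exact DifferentiableOn.fun_div (by fun_prop) (by fun_prop)
      fun z hz => one_sub_conj_mul_ne_zero α hz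

lemma integral_conj_szego_mul {F : ℂ → ℂ} (hF : IsDisc F) (α : 𝔻) :
    ∫ x, conj (szego (α : ℂ) (pt x)) * F (pt x) ∂haar = F (α : ℂ) := by
  rw [← DiffContOnCl.circleAverage_smul_div (R := 1) (c := 0) (w := (α : ℂ)) (f := F)
    (by simpa using hF) (by simpa using α.norm_lt_one), ← integral_haar_eq_circleAverage]
  refine integral_congr_ae (Eventually.of_forall fun x => ?_)
  have h0 : (pt x : ℂ) ≠ 0 := Circle.coe_ne_zero _
  have hkernel : conj (szego (α : ℂ) (pt x)) = (pt x : ℂ) / (pt x - α) := by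
    rw [szego, map_inv₀, map_sub, map_one, map_mul, Complex.conj_conj, ← Circle.coe_inv_eq_conj,
      Circle.coe_inv, ← div_eq_mul_inv, one_sub_div h0, inv_div]
  simp only [hkernel, sub_zero, smul_eq_mul]

lemma norm_moebius_lt_one (α : 𝔻) {z : ℂ} (hz : ‖z‖ < 1) : ‖moebius (α : ℂ) z‖ < 1 := by
  have hne := one_sub_conj_mul_ne_zero α (z := z) (by simpa using hz.le)
  rw [moebius, norm_div, div_lt_one (norm_pos_iff.mpr hne)]
  refine lt_of_pow_lt_pow_left₀ 2 (norm_nonneg _) ?_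
  rw [← Complex.normSq_eq_norm_sq, ← Complex.normSq_eq_norm_sq]
  have hsub : Complex.normSq (1 - conj (α : ℂ) * z) - Complex.normSq (z - α) =
      (1 - Complex.normSq z) * (1 - Complex.normSq (α : ℂ)) := by
    simp only [Complex.normSq_apply, Complex.sub_re, Complex.sub_im, Complex.mul_re,
      Complex.mul_im, Complex.conj_re, Complex.conj_im, Complex.one_re, Complex.one_im]
    ring
  have hpos {w : ℂ} (hw : ‖w‖ < 1) : 0 < 1 - Complex.normSq w := by
    rw [Complex.normSq_eq_norm_sq, sub_pos]
    exact pow_lt_one₀ (norm_nonneg w) hw two_ne_zero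
  linarith [mul_pos (hpos hz) (hpos α.norm_lt_one)]

lemma IsDisc.comp_moebius {F : ℂ → ℂ} (hF : IsDisc F) (α : 𝔻) :
    IsDisc fun z => F (moebius (α : ℂ) z) :=
  DiffContOnCl.comp hF (isDisc_moebius α) fun z hz => by
    simpa using norm_moebius_lt_one α (by simpa using hz)

/-! ### Logarithms -/

lemma exists_continuousOn_log {E : Type*} [NormedAddCommGroup E] [NormedSpace ℝ E] {s : Set E}
    (hs : Convex ℝ s) (hne : s.Nonempty) {F : E → ℂ} (hF : ContinuousOn F s)
    (h0 : ∀ z ∈ s, F z ≠ 0) :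
    ∃ L : E → ℂ, ContinuousOn L s ∧ ∀ z ∈ s, Complex.exp (L z) = F z := by
  have := hs.contractibleSpace hne
  have := hs.locallyPathConnectedSpace
  obtain ⟨z₀, hz₀⟩ := hne
  obtain ⟨f, ⟨-, hf⟩, -⟩ := Complex.isCoveringMapOn_exp.existsUnique_continuousMap_lifts
    ⟨s.domRestrict F, continuousOn_iff_continuous_domRestrict.mp hF⟩ (a₀ := ⟨z₀, hz₀⟩)
    (Complex.exp_log (h0 z₀ hz₀)) (fun z => h0 z z.2)
  have hL (z : s) : Function.extend Subtype.val f 0 (z : E) = f z :=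
    Subtype.val_injective.extend_apply _ _ _
  refine ⟨Function.extend Subtype.val f 0, ?_, fun z hz => ?_⟩
  · rw [continuousOn_iff_continuous_domRestrict]
    exact f.continuous.congr fun z => (hL z).symm
  · rw [hL ⟨z, hz⟩]
    exact congrFun hf ⟨z, hz⟩

lemma exists_isDisc_log {F : ℂ → ℂ} (hF : IsDisc F)
    (h0 : ∀ z ∈ Metric.closedBall (0 : ℂ) 1, F z ≠ 0) :
    ∃ L : ℂ → ℂ, IsDisc L ∧ ∀ z ∈ Metric.closedBall (0 : ℂ) 1, Complex.exp (L z) = F z := by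
  obtain ⟨L, hL, hexp⟩ := exists_continuousOn_log (convex_closedBall (0 : ℂ) 1) ⟨0, by simp⟩
    hF.continuousOn_ball h0
  refine ⟨L, DiffContOnCl.mk_ball (fun z hz => ?_) hL, hexp⟩
  have hnhds : Metric.closedBall (0 : ℂ) 1 ∈ 𝓝 z :=
    mem_of_superset (Metric.isOpen_ball.mem_nhds hz) Metric.ball_subset_closedBall
  have hFz := (hF.1.differentiableAt (Metric.isOpen_ball.mem_nhds hz)).hasDerivAt
  exact (HasDerivAt.of_comp_left (hL.continuousAt hnhds) (Complex.hasDerivAt_exp _) hFz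
    (Complex.exp_ne_zero _) (eventually_of_mem hnhds hexp)).differentiableAt.differentiableWithinAt

/-! ### Extension of analytic symbols to the disc -/

/-- The Wiener algebra: matrix functions whose entries have absolutely convergent Fourier
series. -/
def IsWiener (a : Circle → Mat m) : Prop := ∀ i j, Summable fun n : ℤ => ‖coeff a n i j‖

open scoped Matrix.Norms.Elementwise in
lemma MemWK.isWiener {a : Circle → Mat m} (ha : MemWK a) : IsWiener a := fun _ _ =>
  Summable.of_nonneg_of_le (fun _ => norm_nonneg _)
    (fun n => Matrix.norm_entry_le_entrywise_sup_norm (coeff a n)) ha.2.1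

/-- The holomorphic extension `∑ a_n z^n` (`n ≥ 0`) to the disc of an analytic matrix function. -/
def discExt (a : Circle → Mat m) (z : ℂ) : Mat m :=
  Matrix.of fun i j => ∑' n : ℕ, coeff a (n : ℤ) i j * z ^ n

lemma isDisc_discExt {a : Circle → Mat m} (hw : IsWiener a) (i j : Fin m) :
    IsDisc fun z => discExt a z i j := by
  have hs : Summable fun n : ℕ => ‖coeff a (n : ℤ) i j‖ :=
    (hw i j).comp_injective Nat.cast_injective
  have hle : ∀ (n : ℕ) (z : ℂ), ‖z‖ ≤ 1 →
      ‖coeff a (n : ℤ) i j * z ^ n‖ ≤ ‖coeff a (n : ℤ) i j‖ := by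
    intro n z hz
    rw [norm_mul, norm_pow]
    exact mul_le_of_le_one_right (norm_nonneg _) (pow_le_one₀ (norm_nonneg _) hz)
  refine DiffContOnCl.mk_ball ?_ ?_
  · exact Complex.differentiableOn_tsum_of_summable_norm hs (fun n => by fun_prop)
      Metric.isOpen_ball fun n z hz => hle n z (mem_ball_zero_iff.mp hz).le
  · exact continuousOn_tsum (fun n => by fun_prop) hs fun n z hz =>
      hle n z (mem_closedBall_zero_iff.mp hz)

lemma pt_surjective : Function.Surjective pt := by
  intro t
  refine ⟨(AddCircle.homeomorphCircle (T := 1) one_ne_zero).symm t, ?_⟩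
  rw [pt, ← AddCircle.homeomorphCircle_apply one_ne_zero, Homeomorph.apply_symm_apply]

lemma IsPlus.discExt_circle {a : Circle → Mat m} (ha : IsPlus a) (hw : IsWiener a) (t : Circle) :
    discExt a (t : ℂ) = a t := by
  obtain ⟨x, rfl⟩ := pt_surjective t
  ext i j
  let f : C(UnitAddCircle, ℂ) :=
    ⟨fun x => a (pt x) i j, (ha.continuous.matrix_elem i j).comp continuous_pt⟩
  have h := has_pointwise_sum_fourier_series_of_summable (f := f) (Summable.of_norm (hw i j)) x
  rw [← (Nat.cast_injective (R := ℤ)).hasSum_iff] at h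
  · rw [discExt, Matrix.of_apply]
    refine Eq.trans (tsum_congr fun n => ?_) h.tsum_eq
    rw [Function.comp_apply, ← zpowFn_pt, zpowFn_apply, zpow_natCast, smul_eq_mul]
    rfl
  · intro n hn
    have hn0 : n < 0 := by
      by_contra hneg
      exact hn ⟨n.toNat, Int.toNat_of_nonneg (not_lt.mp hneg)⟩
    rw [show fourierCoeff f n = coeff a n i j from rfl, ha.coeff_neg n hn0, Matrix.zero_apply,
      zero_smul]

lemma IsPlusFactor.discExt_circle {w : Circle → Mat m} (hw : IsPlusFactor w) (t : Circle) :
    discExt w t = w t :=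
  hw.isPlus.discExt_circle hw.memWK.isWiener t

lemma IsPlusFactor.isDisc_det_discExt {w : Circle → Mat m} (hw : IsPlusFactor w) :
    IsDisc fun z => (discExt w z).det :=
  IsDisc.det (isDisc_discExt hw.memWK.isWiener)

lemma IsPlusFactor.det_discExt_ne_zero {w : Circle → Mat m} (hw : IsPlusFactor w) {z : ℂ}
    (hz : z ∈ Metric.closedBall (0 : ℂ) 1) : (discExt w z).det ≠ 0 := by
  have hcircle (t : Circle) : (discExt w t).det * (discExt (invSymbol w) t).det = 1 := by
    rw [hw.discExt_circle, IsPlus.discExt_circle (a := invSymbol w) hw.inv_isPlus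
      hw.inv_memWK.isWiener, invSymbol, ← Matrix.det_mul,
      Matrix.mul_nonsing_inv _ ((Matrix.isUnit_iff_isUnit_det _).mp (hw.isUnit t)),
      Matrix.det_one]
  exact left_ne_zero_of_mul_eq_one <|
    (hw.isDisc_det_discExt.fun_mul (IsDisc.det (isDisc_discExt hw.inv_memWK.isWiener))).eqOn
      (diffContOnCl_const (c := (1 : ℂ))) hcircle hz

lemma IsPlusFactor.exists_log_det_discExt {w : Circle → Mat m} (hw : IsPlusFactor w) :
    ∃ L : ℂ → ℂ, IsDisc L ∧
      ∀ z ∈ Metric.closedBall (0 : ℂ) 1, Complex.exp (L z) = (discExt w z).det :=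
  exists_isDisc_log hw.isDisc_det_discExt fun _ hz => hw.det_discExt_ne_zero hz

/-! ### Geometric means -/

lemma continuous_moebiusCircle (α : 𝔻) : Continuous (moebiusCircle α) :=
  Continuous.subtype_mk (isDisc_moebius α).continuous_circle _

lemma IsDisc.circleAverage_comp_moebius {L : ℂ → ℂ} (hL : IsDisc L) (α : 𝔻) :
    Real.circleAverage (fun z => L (moebius ((-α : 𝔻) : ℂ) z)) 0 1 = L α := by
  rw [DiffContOnCl.circleAverage (by simpa using hL.comp_moebius (-α))]
  simp [moebius]

lemma IsDisc.circleIntegrable {F : ℂ → ℂ} (hF : IsDisc F) : CircleIntegrable F 0 1 :=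
  (hF.continuousOn_ball.mono Metric.sphere_subset_closedBall).circleIntegrable zero_le_one

lemma IsDisc.circleAverage_add_conj_comp_moebius {L₁ L₂ : ℂ → ℂ} (hL₁ : IsDisc L₁)
    (hL₂ : IsDisc L₂) (α : 𝔻) :
    Real.circleAverage (fun z => L₁ (moebius ((-α : 𝔻) : ℂ) z) +
      conj (L₂ (moebius ((-α : 𝔻) : ℂ) z))) 0 1 = L₁ α + conj (L₂ α) := by
  have hint := (hL₂.comp_moebius (-α)).circleIntegrable
  have hconj := ContinuousLinearMap.circleAverage_comp_comm
    (Complex.conjCLE : ℂ →L[ℝ] ℂ) hint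
  have hconj_int : CircleIntegrable (fun z => conj (L₂ (moebius ((-α : 𝔻) : ℂ) z))) 0 1 :=
    ((Complex.continuous_conj.comp_continuousOn
      (hL₂.comp_moebius (-α)).continuousOn_ball).mono
        Metric.sphere_subset_closedBall).circleIntegrable zero_le_one
  rw [Real.circleAverage_fun_add (hL₁.comp_moebius (-α)).circleIntegrable hconj_int,
    hL₁.circleAverage_comp_moebius, ← hL₂.circleAverage_comp_moebius α]
  exact congrArg _ hconj

theorem isGeometricMean_comp_moebius {a vp vm : Circle → Mat m} (hvp : IsPlusFactor vp)
    (hvm : IsMinusFactor vm) (hav : ∀ t, a t = vp t * vm t) (α : 𝔻) :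
    IsGeometricMean (a ∘ moebiusCircle (-α))
      ((discExt vp α).det * conj (discExt (conjSymbol vm) α).det) := by
  replace hvm : IsPlusFactor (conjSymbol vm) := hvm
  obtain ⟨L₁, hL₁, hexp₁⟩ := hvp.exists_log_det_discExt
  obtain ⟨L₂, hL₂, hexp₂⟩ := hvm.exists_log_det_discExt
  have hα : (α : ℂ) ∈ Metric.closedBall (0 : ℂ) 1 := by simpa using α.norm_lt_one.le
  have hμ := continuous_moebiusCircle (-α)
  refine ⟨fun t => L₁ (moebiusCircle (-α) t) + conj (L₂ (moebiusCircle (-α) t)),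
    (hL₁.continuous_circle.comp hμ).add
      (Complex.continuous_conj.comp (hL₂.continuous_circle.comp hμ)), fun t => ?_, ?_⟩
  · rw [Complex.exp_add, Complex.exp_conj, hexp₁ _ (coe_circle_mem_closedBall _),
      hexp₂ _ (coe_circle_mem_closedBall _), hvp.discExt_circle, hvm.discExt_circle,
      Function.comp_apply, hav, Matrix.det_mul]
    congr 1
    simp [conjSymbol, ← RingHom.mapMatrix_apply, ← RingHom.map_det]
  · rw [← hexp₁ _ hα, ← hexp₂ _ hα, ← Complex.exp_conj, ← Complex.exp_add,
      ← hL₁.circleAverage_add_conj_comp_moebius hL₂, ← integral_circle_exp_eq_circleAverage]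
    rfl

end

section

variable {m : ℕ}

/-! ### Multiplication by scalar functions -/

lemma mulOp_scalar_mul (u v : C(Circle, ℂ)) :
    mulOp (scalarSymbol m (u * v : C(Circle, ℂ))) =
      mulOp (scalarSymbol m u) ∘L mulOp (scalarSymbol m v) := by
  rw [← mulOp_mul (continuous_scalarSymbol u) (continuous_scalarSymbol v)]
  congr 1
  funext t
  simp only [scalarSymbol, ContinuousMap.mul_apply, smul_mul_smul_comm, one_mul]

lemma mulOp_scalar_one : mulOp (scalarSymbol m (1 : C(Circle, ℂ))) = 1 := by
  rw [← mulOp_one]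
  exact congrArg mulOp (funext fun _ => one_smul ℂ 1)

lemma inner_mulOp_scalar_left (u : C(Circle, ℂ)) (f g : L2 m) :
    inner ℂ (mulOp (scalarSymbol m u) f) g =
      inner ℂ f (mulOp (scalarSymbol m (star u : C(Circle, ℂ))) g) := by
  rw [inner_mulOp_left (continuous_scalarSymbol u)]
  congr 3
  funext t
  simp [scalarSymbol, Matrix.conjTranspose_smul]

lemma mulOp_scalar_comm {a : Circle → Mat m} (ha : Continuous a) (u : C(Circle, ℂ)) (f : L2 m) :
    mulOp a (mulOp (scalarSymbol m u) f) = mulOp (scalarSymbol m u) (mulOp a f) := by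
  rw [← ContinuousLinearMap.comp_apply, ← ContinuousLinearMap.comp_apply,
    ← mulOp_mul ha (continuous_scalarSymbol u), ← mulOp_mul (continuous_scalarSymbol u) ha]
  simp only [scalarSymbol, mul_smul_comm, smul_mul_assoc, mul_one, one_mul]

lemma inner_contVec_contVec (h g : C(Circle, ℂ)) (i j : Fin m) :
    inner ℂ (contVec i h) (contVec j g) =
      ∫ x, conj (h (pt x)) * ((1 : Mat m) i j * g (pt x)) ∂haar := by
  rw [← inner_contVec_mulOp (continuous_const (y := (1 : Mat m))), mulOp_one, one_apply_eq_self]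

lemma mulOp_scalar_star_mem_H2_iff (u : C(Circle, ℂ)) (g : L2 m) :
    mulOp (scalarSymbol m (star u : C(Circle, ℂ))) g ∈ H2 m ↔
      ∀ n : ℤ, n < 0 → ∀ i, inner ℂ (contVec i (u * zpowFn n)) g = 0 := by
  simp only [mem_H2_iff, ← inner_mulOp_scalar_left, monomial, mulOp_scalar_contVec]

/-- The restriction to the circle of a function `F` of the disc algebra. -/
def discFn (F : ℂ → ℂ) (hF : IsDisc F) : C(Circle, ℂ) := ⟨fun t => F t, hF.continuous_circle⟩

lemma discFn_apply {F : ℂ → ℂ} (hF : IsDisc F) (t : Circle) : discFn F hF t = F t := rfl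

lemma contVec_discFn_mem_H2 {F : ℂ → ℂ} (hF : IsDisc F) (i : Fin m) :
    contVec i (discFn F hF) ∈ H2 m := by
  rw [mem_H2_iff]
  intro n hn j
  obtain ⟨k, hk⟩ : ∃ k : ℕ, -n = (k + 1 : ℕ) := ⟨(-n - 1).toNat, by omega⟩
  have hd : IsDisc fun z => z ^ (k + 1) * ((1 : Mat m) j i * F z) :=
    IsDisc.fun_mul (differentiable_pow (k + 1)).diffContOnCl
      (IsDisc.fun_mul diffContOnCl_const hF)
  have hmean := DiffContOnCl.circleAverage (R := 1) (c := 0) (by simpa using hd)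
  rw [zero_pow k.succ_ne_zero, zero_mul, ← integral_haar_eq_circleAverage] at hmean
  rw [monomial, inner_contVec_contVec, ← hmean]
  simp only [conj_zpowFn, discFn_apply, hk, zpow_natCast]

/-! ### Blaschke factors -/

lemma exists_blaschkeFactor_eq (α : ℂ) :
    ∃ c : ℂ, ‖c‖ = 1 ∧ blaschkeFactor α = fun z => c * moebius α z := by
  by_cases h : α = 0
  · exact ⟨1, norm_one, by ext z; simp [blaschkeFactor, h, moebius]⟩
  · refine ⟨-conj α / (‖α‖ : ℂ), ?_, funext fun z => by rw [blaschkeFactor, if_neg h]⟩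
    rw [norm_div, norm_neg, RCLike.norm_conj, Complex.norm_real, norm_norm,
      div_self (norm_ne_zero_iff.mpr h)]

lemma isDisc_blaschkeFactor (α : 𝔻) : IsDisc (blaschkeFactor (α : ℂ)) := by
  obtain ⟨c, -, h⟩ := exists_blaschkeFactor_eq (α : ℂ)
  rw [h]
  exact IsDisc.fun_mul diffContOnCl_const (isDisc_moebius α)

lemma norm_blaschkeFactor (α : 𝔻) (t : Circle) : ‖blaschkeFactor (α : ℂ) (t : ℂ)‖ = 1 := by
  obtain ⟨c, hc, h⟩ := exists_blaschkeFactor_eq (α : ℂ)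
  rw [h, norm_mul, hc, norm_moebius, one_mul]

lemma blaschkeFactor_self (α : ℂ) : blaschkeFactor α α = 0 := by
  obtain ⟨c, -, h⟩ := exists_blaschkeFactor_eq α
  simp only [h, moebius, sub_self, zero_div, mul_zero]

lemma discFn_moebius_mul_zpowFn_neg_one (α : 𝔻) :
    discFn _ (isDisc_moebius α) * zpowFn (-1) =
      (1 - (α : ℂ) * conj (α : ℂ)) • discFn _ (isDisc_szego α) - (α : ℂ) • zpowFn (-1) := by
  ext t
  have hd := one_sub_conj_mul_ne_zero α (coe_circle_mem_closedBall t)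
  have ht : (t : ℂ) ≠ 0 := Circle.coe_ne_zero t
  simp only [ContinuousMap.mul_apply, ContinuousMap.sub_apply, ContinuousMap.smul_apply,
    discFn_apply, zpowFn_apply, moebius, szego, smul_eq_mul, zpow_neg_one]
  generalize hd' : 1 - conj (α : ℂ) * t = d at hd ⊢
  field_simp
  rw [← hd']
  ring

lemma discFn_moebius_mul_zpowFn_sub_one (α : 𝔻) (n : ℤ) :
    discFn _ (isDisc_moebius α) * zpowFn (n - 1) =
      zpowFn n - (α : ℂ) • zpowFn (n - 1) +
        conj (α : ℂ) • (discFn _ (isDisc_moebius α) * zpowFn n) := by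
  ext t
  have hd := one_sub_conj_mul_ne_zero α (coe_circle_mem_closedBall t)
  have ht : (t : ℂ) ≠ 0 := Circle.coe_ne_zero t
  simp only [ContinuousMap.mul_apply, ContinuousMap.add_apply, ContinuousMap.sub_apply,
    ContinuousMap.smul_apply, discFn_apply, zpowFn_apply, moebius, smul_eq_mul, zpow_sub_one₀ ht]
  generalize hd' : 1 - conj (α : ℂ) * t = d at hd ⊢
  field_simp
  rw [← hd']
  ring

lemma inner_discFn_moebius_mul_zpowFn (α : 𝔻) {g : L2 m} (hg : g ∈ H2 m) (i : Fin m)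
    (h : inner ℂ (contVec i (discFn _ (isDisc_szego α))) g = 0) {n : ℤ} (hn : n ≤ -1) :
    inner ℂ (contVec i (discFn _ (isDisc_moebius α) * zpowFn n)) g = 0 := by
  have hzpow (k : ℤ) (hk : k ≤ -1) : inner ℂ (contVec i (zpowFn k)) g = 0 :=
    (mem_H2_iff g).mp hg k (by omega) i
  induction n, hn using Int.leInductionDown with
  | base =>
    rw [discFn_moebius_mul_zpowFn_neg_one, map_sub, map_smul, map_smul, inner_sub_left,
      inner_smul_left, inner_smul_left, h, hzpow _ le_rfl, mul_zero, mul_zero, sub_zero]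
  | pred n hn ih =>
    rw [discFn_moebius_mul_zpowFn_sub_one, map_add, map_sub, map_smul, map_smul, inner_add_left,
      inner_sub_left, inner_smul_left, inner_smul_left, ih, hzpow _ hn, hzpow _ (by omega),
      mul_zero, mul_zero, sub_zero, add_zero]

/-- Since `|B_α| = 1` on the circle, multiplication by `star B_α` divides `g` by `B_α`. -/
lemma mulOp_star_blaschkeFactor_mem_H2 (α : 𝔻) {g : L2 m} (hg : g ∈ H2 m)
    (h : ∀ i, inner ℂ (contVec i (discFn _ (isDisc_szego α))) g = 0) :
    mulOp (scalarSymbol m (star (discFn _ (isDisc_blaschkeFactor α)) : C(Circle, ℂ))) g ∈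
      H2 m := by
  obtain ⟨c, -, hc⟩ := exists_blaschkeFactor_eq (α : ℂ)
  have hsmul : discFn _ (isDisc_blaschkeFactor α) = c • discFn _ (isDisc_moebius α) :=
    ContinuousMap.ext fun t => congrFun hc t
  rw [mulOp_scalar_star_mem_H2_iff]
  intro n hn i
  rw [hsmul, smul_mul_assoc, map_smul, inner_smul_left,
    inner_discFn_moebius_mul_zpowFn α hg i (h i) (Int.le_sub_one_of_lt hn), mul_zero]

/-! ### The Takenaka–Malmquist basis of the model space -/

variable {N : ℕ} (α : Fin N → 𝔻)

/-- The product of the Blaschke factors with index in `s`, as a function on the plane. For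
`s = Finset.Iio j` these are the partial products in the Takenaka–Malmquist functions. -/
def partialBlaschke (s : Finset (Fin N)) (z : ℂ) : ℂ := ∏ l ∈ s, blaschkeFactor (α l : ℂ) z

lemma isDisc_partialBlaschke (s : Finset (Fin N)) : IsDisc (partialBlaschke α s) :=
  IsDisc.fun_prod s fun l _ => isDisc_blaschkeFactor (α l)

lemma conj_partialBlaschke_mul_self (s : Finset (Fin N)) (t : Circle) :
    conj (partialBlaschke α s t) * partialBlaschke α s t = 1 := by
  rw [Complex.conj_mul', partialBlaschke, norm_prod,
    Finset.prod_congr rfl fun l _ => norm_blaschkeFactor (α l) t]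
  simp

lemma partialBlaschke_eq_zero {s : Finset (Fin N)} {j : Fin N} (hj : j ∈ s) :
    partialBlaschke α s (α j : ℂ) = 0 :=
  Finset.prod_eq_zero hj (blaschkeFactor_self _)

/-- The boundary function of `partialBlaschke α s`. -/
def blaschkeFn (s : Finset (Fin N)) : C(Circle, ℂ) := discFn _ (isDisc_partialBlaschke α s)

lemma blaschkeFn_apply (s : Finset (Fin N)) (t : Circle) :
    blaschkeFn α s t = partialBlaschke α s t := rfl

lemma coe_blaschkeFn_univ : blaschkeFn α Finset.univ = blaschke α := rfl

lemma blaschkeFn_empty : blaschkeFn α ∅ = 1 :=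
  ContinuousMap.ext fun _ => rfl

lemma blaschkeFn_insert {s : Finset (Fin N)} {j : Fin N} (hj : j ∉ s) :
    blaschkeFn α (insert j s) = discFn _ (isDisc_blaschkeFactor (α j)) * blaschkeFn α s :=
  ContinuousMap.ext fun _ => Finset.prod_insert hj

lemma blaschkeFn_mul_star (s : Finset (Fin N)) : blaschkeFn α s * star (blaschkeFn α s) = 1 :=
  ContinuousMap.ext fun t => (mul_comm _ _).trans (conj_partialBlaschke_mul_self α s t)

/-- The Takenaka–Malmquist function
`√(1 - |α_j|²) B_{α_1}(z) ⋯ B_{α_{j-1}}(z) / (1 - \bar α_j z)`. -/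
def tmFun (j : Fin N) (z : ℂ) : ℂ :=
  (Real.sqrt (1 - ‖(α j : ℂ)‖ ^ 2) : ℂ) * (partialBlaschke α (Finset.Iio j) z * szego (α j) z)

lemma isDisc_tmFun (j : Fin N) : IsDisc (tmFun α j) :=
  IsDisc.fun_mul diffContOnCl_const
    (IsDisc.fun_mul (isDisc_partialBlaschke α _) (isDisc_szego (α j)))

/-- The vector-valued function `t ↦ tmFun α j t • e_i` in `L²`; these functions, indexed by
`(j, i)`, form the Takenaka–Malmquist basis of the model space of `blaschke α`. -/
def tmVec (p : Fin N × Fin m) : L2 m := contVec p.2 (discFn _ (isDisc_tmFun α p.1))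

lemma one_sub_norm_sq_pos (β : 𝔻) : 0 < 1 - ‖(β : ℂ)‖ ^ 2 :=
  sub_pos.mpr (pow_lt_one₀ (norm_nonneg _) β.norm_lt_one two_ne_zero)

lemma sqrt_mul_sqrt_mul_szego_self (β : 𝔻) :
    (Real.sqrt (1 - ‖(β : ℂ)‖ ^ 2) : ℂ) *
      ((Real.sqrt (1 - ‖(β : ℂ)‖ ^ 2) : ℂ) * szego β β) = 1 := by
  have hpos := one_sub_norm_sq_pos β
  have hden : 1 - conj (β : ℂ) * β = ((1 - ‖(β : ℂ)‖ ^ 2 : ℝ) : ℂ) := by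
    rw [Complex.conj_mul']; push_cast; rfl
  rw [← mul_assoc, ← Complex.ofReal_mul, Real.mul_self_sqrt hpos.le, szego, hden,
    mul_inv_cancel₀ (Complex.ofReal_ne_zero.mpr hpos.ne')]

/-- On the circle the conjugate of the Blaschke product in `tmFun` is its reciprocal, so the
remaining integral is evaluated by the reproducing property of the Szegő kernel. -/
lemma integral_conj_tmFun_mul (j : Fin N) {s : Finset (Fin N)} (hs : Finset.Iio j ⊆ s)
    {F : ℂ → ℂ} (hF : IsDisc F) :
    ∫ x, conj (tmFun α j (pt x)) * (partialBlaschke α s (pt x) * F (pt x)) ∂haar =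
      (Real.sqrt (1 - ‖(α j : ℂ)‖ ^ 2) : ℂ) *
        (partialBlaschke α (s \ Finset.Iio j) (α j) * F (α j)) := by
  have hd : IsDisc fun z => (Real.sqrt (1 - ‖(α j : ℂ)‖ ^ 2) : ℂ) *
      (partialBlaschke α (s \ Finset.Iio j) z * F z) :=
    IsDisc.fun_mul diffContOnCl_const (IsDisc.fun_mul (isDisc_partialBlaschke α _) hF)
  rw [← integral_conj_szego_mul hd (α j)]
  refine integral_congr_ae (.of_forall fun x => ?_)
  have hsplit : partialBlaschke α s (pt x) =
      partialBlaschke α (s \ Finset.Iio j) (pt x) * partialBlaschke α (Finset.Iio j) (pt x) :=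
    (Finset.prod_sdiff hs).symm
  simp only [tmFun, map_mul, Complex.conj_ofReal]
  rw [hsplit]
  linear_combination (Real.sqrt (1 - ‖(α j : ℂ)‖ ^ 2) : ℂ) * conj (szego (α j : ℂ) (pt x)) *
    partialBlaschke α (s \ Finset.Iio j) (pt x) * F (pt x) *
    conj_partialBlaschke_mul_self α (Finset.Iio j) (pt x)

lemma inner_tmVec_mulOp {v : Circle → Mat m} (hv : Continuous v) {V : ℂ → Mat m}
    (hV : ∀ i j, IsDisc fun z => V z i j) (hVv : ∀ t : Circle, V t = v t)
    {j l : Fin N} (hjl : j ≤ l) (i p : Fin m) :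
    inner ℂ (tmVec α (j, i)) (mulOp v (tmVec α (l, p))) = if j = l then V (α j) i p else 0 := by
  have hF : IsDisc fun z => V z i p * ((Real.sqrt (1 - ‖(α l : ℂ)‖ ^ 2) : ℂ) * szego (α l) z) :=
    IsDisc.fun_mul (hV i p) (IsDisc.fun_mul diffContOnCl_const (isDisc_szego (α l)))
  have hint := integral_conj_tmFun_mul α j (Finset.Iio_subset_Iio hjl) hF
  rw [tmVec, tmVec, inner_contVec_mulOp hv]
  refine Eq.trans (integral_congr_ae (.of_forall fun x => ?_)) (hint.trans ?_)
  · simp only [discFn_apply, tmFun, ← hVv]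
    ring
  · split_ifs with h
    · subst h
      rw [sdiff_self, Finset.bot_eq_empty, partialBlaschke, Finset.prod_empty, one_mul,
        mul_left_comm, sqrt_mul_sqrt_mul_szego_self, mul_one]
    · have hj : j ∈ Finset.Iio l \ Finset.Iio j := by simp [lt_of_le_of_ne hjl h]
      rw [partialBlaschke_eq_zero α hj, zero_mul, mul_zero]

lemma inner_tmVec_tmVec_of_le {j l : Fin N} (hjl : j ≤ l) (i p : Fin m) :
    inner ℂ (tmVec α (j, i)) (tmVec α (l, p)) = if (j, i) = (l, p) then (1 : ℂ) else 0 := by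
  have h := inner_tmVec_mulOp α (v := fun _ => (1 : Mat m)) continuous_const
    (V := fun _ => 1) (fun _ _ => diffContOnCl_const) (fun _ => rfl) hjl i p
  rw [mulOp_one, one_apply_eq_self] at h
  simp only [h, Matrix.one_apply, Prod.mk.injEq, ite_and]

lemma orthonormal_tmVec : Orthonormal ℂ (tmVec (m := m) α) := by
  rw [orthonormal_iff_ite]
  rintro ⟨j, i⟩ ⟨l, p⟩
  rcases le_total j l with h | h
  · exact inner_tmVec_tmVec_of_le α h i p
  · rw [← inner_conj_symm, inner_tmVec_tmVec_of_le α h p i, apply_ite conj, map_one, map_zero]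
    simp only [eq_comm]

lemma tmVec_mem_H2 (p : Fin N × Fin m) : tmVec α p ∈ H2 m := contVec_discFn_mem_H2 _ _

lemma mulOp_star_blaschke_tmVec (p : Fin N × Fin m) :
    mulOp (scalarSymbol m (star (blaschkeFn α Finset.univ) : C(Circle, ℂ))) (tmVec α p) ∈
      (H2 m)ᗮ := by
  rw [mem_H2_orthogonal_iff]
  intro n hn i
  lift n to ℕ using hn
  rw [← inner_mulOp_scalar_left, ← inner_conj_symm, map_eq_zero, monomial, mulOp_scalar_contVec,
    tmVec, inner_contVec_contVec]
  have hint := integral_conj_tmFun_mul α p.1 (Finset.subset_univ _)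
    (F := fun z => (1 : Mat m) p.2 i * z ^ n)
    (IsDisc.fun_mul diffContOnCl_const (differentiable_pow n).diffContOnCl)
  rw [partialBlaschke_eq_zero α (by simp), zero_mul, mul_zero] at hint
  simpa only [ContinuousMap.mul_apply, discFn_apply, blaschkeFn_apply, zpowFn_apply, zpow_natCast,
    mul_left_comm ((1 : Mat m) p.2 i)] using hint

lemma tmVec_mem_modelSpace (p : Fin N × Fin m) :
    (⟨tmVec α p, tmVec_mem_H2 α p⟩ : H2 m) ∈ modelSpace m (blaschke α) := by
  rw [modelSpace, Submodule.mem_orthogonal]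
  rintro g ⟨h, hh, hg : mulOp (scalarSymbol m (blaschke α)) h = g⟩
  rw [Submodule.coe_inner, ← hg, ← coe_blaschkeFn_univ, inner_mulOp_scalar_left]
  exact (Submodule.mem_orthogonal _ _).mp (mulOp_star_blaschke_tmVec α p) h hh

/-- `tmVec α p` as an element of the model space. -/
def tmModel (p : Fin N × Fin m) : modelSpace m (blaschke α) :=
  ⟨⟨tmVec α p, tmVec_mem_H2 α p⟩, tmVec_mem_modelSpace α p⟩

lemma orthonormal_tmModel : Orthonormal ℂ (tmModel (m := m) α) := by
  have h := orthonormal_tmVec (m := m) α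
  rw [orthonormal_iff_ite] at h ⊢
  exact h

lemma mulOp_star_blaschkeFn_insert_mem_H2 {f : L2 m} (j : Fin N)
    (hf : ∀ i, inner ℂ (tmVec α (j, i)) f = 0)
    (h : mulOp (scalarSymbol m (star (blaschkeFn α (Finset.Iio j)) : C(Circle, ℂ))) f ∈ H2 m) :
    mulOp (scalarSymbol m (star (blaschkeFn α (insert j (Finset.Iio j))) : C(Circle, ℂ))) f ∈
      H2 m := by
  rw [blaschkeFn_insert α (by simp), star_mul', mulOp_scalar_mul,
    ContinuousLinearMap.comp_apply]
  refine mulOp_star_blaschkeFactor_mem_H2 (α j) h fun i => ?_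
  rw [← inner_mulOp_scalar_left, mulOp_scalar_contVec]
  have htm : discFn _ (isDisc_tmFun α j) = (Real.sqrt (1 - ‖(α j : ℂ)‖ ^ 2) : ℂ) •
      (blaschkeFn α (Finset.Iio j) * discFn _ (isDisc_szego (α j))) := rfl
  have hfi := hf i
  rw [tmVec, htm, map_smul, inner_smul_left, Complex.conj_ofReal] at hfi
  exact (mul_eq_zero.mp hfi).resolve_left
    (Complex.ofReal_ne_zero.mpr (Real.sqrt_pos.mpr (one_sub_norm_sq_pos (α j))).ne')

lemma mulOp_star_blaschkeFn_mem_H2 {f : L2 m} (hf : f ∈ H2 m)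
    (h : ∀ p, inner ℂ (tmVec α p) f = 0) (k : Fin (N + 1)) :
    mulOp (scalarSymbol m (star (blaschkeFn α {l | l.castSucc < k}) : C(Circle, ℂ))) f ∈
      H2 m := by
  induction k using Fin.induction with
  | zero =>
    rw [show ({l | l.castSucc < 0} : Finset (Fin N)) = ∅ by simp, blaschkeFn_empty, star_one,
      mulOp_scalar_one]
    exact hf
  | succ j ih =>
    have hIio : ({l | l.castSucc < j.castSucc} : Finset (Fin N)) = Finset.Iio j := by
      ext l; simp
    have hinsert : ({l | l.castSucc < j.succ} : Finset (Fin N)) = insert j (Finset.Iio j) := by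
      ext l; simp [Fin.castSucc_lt_succ_iff, le_iff_eq_or_lt]
    rw [hIio] at ih
    rw [hinsert]
    exact mulOp_star_blaschkeFn_insert_mem_H2 α j (fun i => h (j, i)) ih

lemma mem_shiftedH2_of_inner_tmVec_eq_zero (f : H2 m)
    (h : ∀ p, inner ℂ (tmVec α p) (f : L2 m) = 0) : f ∈ shiftedH2 m (blaschke α) := by
  have hquot := mulOp_star_blaschkeFn_mem_H2 α f.2 h (Fin.last N)
  rw [show ({l | l.castSucc < Fin.last N} : Finset (Fin N)) = Finset.univ by
    simp [Fin.castSucc_lt_last]] at hquot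
  refine ⟨_, hquot, ?_⟩
  rw [← coe_blaschkeFn_univ, ContinuousLinearMap.coe_coe, ← ContinuousLinearMap.comp_apply,
    ← mulOp_scalar_mul, blaschkeFn_mul_star, mulOp_scalar_one, one_apply_eq_self]
  rfl

lemma eq_zero_of_inner_tmModel_eq_zero (f : modelSpace m (blaschke α))
    (hf : ∀ p, inner ℂ (tmModel α p) f = 0) : f = 0 := by
  have hmem : (f : H2 m) ∈ shiftedH2 m (blaschke α) :=
    mem_shiftedH2_of_inner_tmVec_eq_zero α (f : H2 m) hf
  have hself := (Submodule.mem_orthogonal _ _).mp f.2 _ hmem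
  exact Subtype.ext (inner_self_eq_zero.mp hself)

/-- The Takenaka–Malmquist basis of the model space of `blaschke α`. -/
def tmBasis (m : ℕ) : OrthonormalBasis (Fin N × Fin m) ℂ (modelSpace m (blaschke α)) :=
  OrthonormalBasis.mkOfOrthogonalEqBot (orthonormal_tmModel α)
    ((Submodule.eq_bot_iff _).mpr fun f hf => eq_zero_of_inner_tmModel_eq_zero α f fun p =>
      (Submodule.mem_orthogonal _ _).mp hf _ (Submodule.subset_span ⟨p, rfl⟩))

lemma tmBasis_apply (p : Fin N × Fin m) : tmBasis α m p = tmModel α p := by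
  rw [tmBasis, OrthonormalBasis.coe_of_orthogonal_eq_bot_mk]

end

/-! ### Compressions to model spaces -/

section

variable {E : Type*} [NormedAddCommGroup E] [InnerProductSpace ℂ E] (W : Submodule ℂ E)
  [W.HasOrthogonalProjection]

lemma compression_mul_of_mapsTo (S : E →L[ℂ] E) {T : E →L[ℂ] E} (hT : ∀ f ∈ W, T f ∈ W) :
    compression W (S * T) = compression W S ∘L compression W T := by
  ext1 f
  exact congrArg (fun g => W.orthogonalProjectionOnto (S g))
    (Submodule.starProjection_eq_self_iff.mpr (hT f f.2)).symm

lemma compression_mul_of_mapsTo_orthogonal {S : E →L[ℂ] E} (hS : ∀ f ∈ Wᗮ, S f ∈ Wᗮ)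
    (T : E →L[ℂ] E) :
    compression W (S * T) = compression W S ∘L compression W T := by
  ext1 f
  have h := hS _ (Submodule.sub_starProjection_mem_orthogonal (K := W) (T f))
  rw [map_sub, ← Submodule.orthogonalProjectionOnto_eq_zero_iff, map_sub, sub_eq_zero] at h
  exact h

variable {m : ℕ}

lemma toeplitz_mem_shiftedH2 {v : Circle → Mat m} (hv : IsPlus v) (u : C(Circle, ℂ)) {f : H2 m}
    (hf : f ∈ shiftedH2 m u) : toeplitz v f ∈ shiftedH2 m u := by
  obtain ⟨h, hh, hfh : mulOp (scalarSymbol m u) h = f⟩ := hf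
  refine ⟨mulOp v h, hv.mulOp_mem hh, ?_⟩
  change mulOp (scalarSymbol m u) (mulOp v h) = (proj m (mulOp v (f : L2 m)) : L2 m)
  rw [coe_proj_of_mem (hv.mulOp_mem f.2), ← hfh, mulOp_scalar_comm hv.continuous]

lemma toeplitz_mem_modelSpace {v : Circle → Mat m} (hv : IsMinus v) (u : C(Circle, ℂ)) {f : H2 m}
    (hf : f ∈ modelSpace m u) : toeplitz v f ∈ modelSpace m u := by
  rw [modelSpace, Submodule.mem_orthogonal'] at hf ⊢
  intro g hg
  rw [inner_toeplitz_left hv.continuous]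
  exact hf _ (toeplitz_mem_shiftedH2 hv u hg)

lemma toeplitz_mem_modelSpace_orthogonal {v : Circle → Mat m} (hv : IsPlus v) (u : C(Circle, ℂ))
    {f : H2 m} (hf : f ∈ (modelSpace m u)ᗮ) : toeplitz v f ∈ (modelSpace m u)ᗮ := by
  rw [Submodule.mem_orthogonal'] at hf ⊢
  intro g hg
  rw [inner_toeplitz_left hv.continuous]
  exact hf _ (toeplitz_mem_modelSpace hv.conjTranspose u hg)

lemma modelToeplitz_eq_of_factorization (u : C(Circle, ℂ)) {a v w : Circle → Mat m}
    (hv : IsPlus v) (hw : IsMinus w) {B : H2 m →L[ℂ] H2 m}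
    (h : toeplitz a = toeplitz v * B * toeplitz w) :
    modelToeplitz u a =
      modelToeplitz u v ∘L compression (modelSpace m u) B ∘L modelToeplitz u w := by
  calc compression (modelSpace m u) (toeplitz a)
      = compression (modelSpace m u) (toeplitz v) ∘L
          compression (modelSpace m u) (B * toeplitz w) := by
        rw [h, mul_assoc, compression_mul_of_mapsTo_orthogonal _
          fun f hf => toeplitz_mem_modelSpace_orthogonal hv u hf]
    _ = _ := by
        rw [compression_mul_of_mapsTo _ _ fun f hf => toeplitz_mem_modelSpace hw u hf]
        rfl

variable {N : ℕ} (α : Fin N → 𝔻)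

/-- The matrix of `T_u(v)`, `u = blaschke α`, in the Takenaka–Malmquist basis. -/
def tmMatrix (v : Circle → Mat m) : Matrix (Fin N × Fin m) (Fin N × Fin m) ℂ :=
  Matrix.of fun p q => inner ℂ (tmVec α p) (mulOp v (tmVec α q))

lemma tmMatrix_apply (v : Circle → Mat m) (p q : Fin N × Fin m) :
    tmMatrix α v p q = inner ℂ (tmVec α p) (mulOp v (tmVec α q)) := rfl

lemma det_modelToeplitz (v : Circle → Mat m) :
    LinearMap.det (modelToeplitz (blaschke α) v).toLinearMap = (tmMatrix α v).det := by
  refine (det_compression _ (tmBasis α m) (toeplitz v)).trans (congrArg Matrix.det ?_)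
  ext p q
  rw [Matrix.of_apply, tmBasis_apply, tmBasis_apply, toeplitz_apply, inner_proj_right]
  rfl

lemma det_tmMatrix_of_isDisc {v : Circle → Mat m} (hv : Continuous v) {V : ℂ → Mat m}
    (hV : ∀ i j, IsDisc fun z => V z i j) (hVv : ∀ t : Circle, V t = v t) :
    (tmMatrix α v).det = ∏ j, (V (α j)).det := by
  have hblock : (tmMatrix α v).transpose.BlockTriangular Prod.fst := by
    rintro ⟨l, p⟩ ⟨j, i⟩ (hjl : j < l)
    rw [Matrix.transpose_apply, tmMatrix_apply, inner_tmVec_mulOp α hv hV hVv hjl.le,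
      if_neg hjl.ne]
  rw [← Matrix.det_transpose, hblock.det_fintype]
  refine Finset.prod_congr rfl fun j _ => ?_
  let e : Fin m ≃ {p : Fin N × Fin m // p.1 = j} :=
    { toFun := fun i => ⟨(j, i), rfl⟩
      invFun := fun p => p.1.2
      left_inv := fun i => rfl
      right_inv := by rintro ⟨⟨l, i⟩, rfl⟩; rfl }
  rw [← Matrix.det_submatrix_equiv_self e, ← Matrix.det_transpose]
  congr 1
  ext i p
  exact (inner_tmVec_mulOp α hv hV hVv (le_refl j) i p).trans (if_pos rfl)

lemma tmMatrix_conjTranspose {v : Circle → Mat m} (hv : Continuous v) :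
    (tmMatrix α fun t => (v t).conjTranspose).conjTranspose = tmMatrix α v := by
  ext p q
  rw [Matrix.conjTranspose_apply, tmMatrix_apply, tmMatrix_apply, ← inner_mulOp_left hv,
    Complex.star_def, inner_conj_symm]

lemma det_modelToeplitz_of_isPlusFactor {v : Circle → Mat m} (hv : IsPlusFactor v) :
    LinearMap.det (modelToeplitz (blaschke α) v).toLinearMap = ∏ j, (discExt v (α j)).det := by
  rw [det_modelToeplitz, det_tmMatrix_of_isDisc α hv.isPlus.continuous
    (isDisc_discExt hv.memWK.isWiener) hv.discExt_circle]

lemma det_modelToeplitz_of_isMinusFactor {v : Circle → Mat m} (hv : IsMinusFactor v) :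
    LinearMap.det (modelToeplitz (blaschke α) v).toLinearMap =
      ∏ j, conj (discExt (conjSymbol v) (α j)).det := by
  have hplus : IsPlusFactor (conjSymbol v) := hv
  have hdet := det_tmMatrix_of_isDisc α hv.isMinus.continuous.matrix_conjTranspose
    (V := fun z => (discExt (conjSymbol v) z).transpose)
    (fun i j => isDisc_discExt hplus.memWK.isWiener j i)
    (fun t => congrArg Matrix.transpose (hplus.discExt_circle t))
  simp only [Matrix.det_transpose] at hdet
  rw [det_modelToeplitz, ← tmMatrix_conjTranspose α hv.isMinus.continuous,
    Matrix.det_conjTranspose, hdet, Complex.star_def, map_prod]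

theorem det_modelToeplitz_of_factorization {a v w : Circle → Mat m} (hv : IsPlusFactor v)
    (hw : IsMinusFactor w) {B : H2 m →L[ℂ] H2 m} (h : toeplitz a = toeplitz v * B * toeplitz w) :
    LinearMap.det (modelToeplitz (blaschke α) a).toLinearMap =
      (∏ j, (discExt v (α j)).det * conj (discExt (conjSymbol w) (α j)).det) *
        LinearMap.det (compression (modelSpace m (blaschke α)) B).toLinearMap := by
  have hcomp := modelToeplitz_eq_of_factorization (blaschkeFn α Finset.univ) hv.isPlus hw.isMinus h
  rw [coe_blaschkeFn_univ] at hcomp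
  rw [hcomp, ContinuousLinearMap.toLinearMap_comp, LinearMap.det_comp,
    ContinuousLinearMap.toLinearMap_comp, LinearMap.det_comp,
    det_modelToeplitz_of_isPlusFactor α hv, det_modelToeplitz_of_isMinusFactor α hw,
    Finset.prod_mul_distrib]
  ring

end

end ModelBO

end

theorem theorem1p1 (m : ℕ) (a wm wp vp vm : Circle → ModelBO.Mat m)
    (ha : ModelBO.MemWK a)
    (hwm : ModelBO.IsMinusFactor wm) (hwp : ModelBO.IsPlusFactor wp)
    (hvp : ModelBO.IsPlusFactor vp) (hvm : ModelBO.IsMinusFactor vm)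
    (haw : ∀ t, a t = wm t * wp t) (hav : ∀ t, a t = vp t * vm t)
    (b c : Circle → ModelBO.Mat m)
    (hb : ∀ t, b t = vm t * (wp t)⁻¹) (hc : ∀ t, c t = (wm t)⁻¹ * vp t)
    (N : ℕ) (α : Fin N → Complex.UnitDisc) (u : Circle → ℂ) (hu : u = ModelBO.blaschke α) :
    FiniteDimensional ℂ (ModelBO.modelSpace m u) ∧
    ∃ (g : Fin N → ℂ) (dQ d : ℂ),
      (∀ j, ModelBO.IsGeometricMean (a ∘ ModelBO.moebiusCircle (-α j)) (g j)) ∧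
      ModelBO.HasFredholmDet
        (1 - ModelBO.Qu m u ∘L ModelBO.hankel b ∘L ModelBO.hankel (ModelBO.tilde c) ∘L
          ModelBO.Qu m u) dQ ∧
      ModelBO.HasFredholmDet
        (1 - ModelBO.hankel b ∘L ModelBO.hankel (ModelBO.tilde c)) d ∧
      d ≠ 0 ∧
      LinearMap.det (ModelBO.modelToeplitz u a).toLinearMap = (∏ j, g j) * (dQ / d) := by
  subst hu
  obtain rfl : b = fun t => vm t * (wp t)⁻¹ := funext hb
  obtain rfl : c = fun t => (wm t)⁻¹ * vp t := funext hc
  obtain rfl : a = fun t => wm t * wp t := funext haw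
  have := (ModelBO.tmBasis α m).toBasis.finiteDimensional_of_finite
  obtain ⟨A, hA, hT⟩ := ModelBO.exists_unit_one_sub_hankel_mul_hankel hwm hwp hvp hvm hav
  have htr := ModelBO.isTraceClass_hankel_mul_hankel hwm hwp hvp hvm
  let Q := ModelBO.Qu m (ModelBO.blaschke α)
  obtain ⟨d, hd⟩ := ModelBO.exists_hasFredholmDet_one_sub htr
  obtain ⟨dQ, hdQ⟩ := ModelBO.exists_hasFredholmDet_one_sub ((htr.comp_right Q).comp_left Q)
  have hdA : ModelBO.HasFredholmDet (A : ModelBO.H2 m →L[ℂ] ModelBO.H2 m) d := hA ▸ hd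
  have hmid := ModelBO.det_compression_inv_mul (ModelBO.modelSpace m (ModelBO.blaschke α))
    (dQ := dQ) hdA (by rw [hA, sub_sub_cancel]; exact hdQ)
  refine ⟨this, fun j => (ModelBO.discExt vp (α j)).det *
    conj (ModelBO.discExt (ModelBO.conjSymbol vm) (α j)).det, dQ, d,
    fun j => ModelBO.isGeometricMean_comp_moebius hvp hvm hav (α j), hdQ, hd, hdA.ne_zero, ?_⟩
  rw [ModelBO.det_modelToeplitz_of_factorization α hvp hvm hT, ← hmid,
    mul_div_cancel_right₀ _ hdA.ne_zero]
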